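/- **Setting.** Let $\Omega>0$, let $f_\Omega(x)=\frac{1}{\sqrt\Omega}\frac{\sin\Omega x}{x}$ (with $f_\Omega(0)=\sqrt\Omega$) be the point spread function with cutoff frequency $\Omega$, and put $f(x)=\frac{\sin x}{x}$ ($f(0)=1$). Let $x_t=-\frac R\Omega+(t-1)\frac h\Omega$, $t=1,\dots,N$, be sample points with $R>0$, $0<h\le\pi$ and $(N-1)h=2R$, so that $x_N=\frac R\Omega$. A discrete measure is $\mu=\sum_{j=1}^k a_j\delta_{y_j}$ with real amplitudes $a_j$ and distinct real positions $y_j$; $\|\mu\|_{TV}=\sum_j|a_j|$, and $[\mu*f_\Omega]=\big(\sum_j a_jf_\Omega(x_t-y_j)\big)_{t=1}^N$. For $s\in\mathbb N$ let $\mathbf H(s)$ be the $N\times s$ matrix with columns $\mathbf h_r=\sqrt{2r+1}\,(f^{(r)}(\Omega x_1),\dots,f^{(r)}(\Omega x_N))^T$, $0\le r\le s-1$, and let $\sigma_{\min}(s)=\sqrt{\lambda_{\min}(h\,\mathbf H(s)^T\mathbf H(s))}$ be the smallest singular value of $\sqrt h\,\mathbf H(s)$. For $\sigma,M,d$ let $$s^*=\min\Big\{l\in\mathbb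 N:\ \frac{d^l}{l!\sqrt{2l+1}}\le\frac{\sigma}{2e^d\sqrt\pi\,M}\Big\}.$$ Given $\mathbf Y\in\mathbb C^N$, the measure $\mu$ is $(d,\sigma,M)$-admissible for $\mathbf Y$ if it is supported in $[-\frac d\Omega,\frac d\Omega]$, $\|\mu\|_{TV}\le M$ and $\sqrt{h/\Omega}\,\|[\mu*f_\Omega]-\mathbf Y\|_2\le\sigma$. Let $n\ge2$ and $\sigma>0$. **(1) Lower bound.** Let $m^*>0$. There is a $d$ with $$\frac{d}{n-1}=\frac2e\sqrt[2n-2]{\frac{2n-2}{e^d}}\ \sqrt[2n-2]{\frac{\sigma}{m^*}},$$ and for every such $d$ there are a measure $\mu^*=\sum_{j=1}^na_j^*\delta_{y_j^*}$ with exactly $n$ support points and a measure $\mu$ with exactly $n-1$ support points, both supported in $[-\frac d\Omega,\frac d\Omega]$, such that $\|\mu\|_{TV}\le\|\mu^*\|_{TV}=m^*$, $\min_{i\ne j}|y_i^*-y_j^*|=\frac{d}{(n-1)\Omega}$ and $\sqrt{h/\Omega}\,\|[\mu*f_\Omega]-[\mu^* *f_\Omega]\|_2\le\sigma$. For (2)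 and (3), let $\mu^*=\sum_{j=1}^na_j^*\delta_{y_j^*}$ with all $a_j^*\ne0$ and $-\frac d\Omega\le y_1^*<\dots<y_n^*\le\frac d\Omega$, let $m_{\min}^*=\min_j|a_j^*|$, $d_{\min}^*=\min_{i\ne j}|y_i^*-y_j^*|$, let $M\ge\|\mu^*\|_{TV}$, and let $\mathbf Y=[\mu^* *f_\Omega]+\sqrt\Omega\,\mathbf W$, where $\mathbf W\in\mathbb C^N$ is any noise vector (for instance the samples of a band-limited noise with cutoff frequency $\Omega$) with $\sqrt h\,\|\mathbf W\|_2\le\sigma$. Assume $\sigma_{\min}(s^*)>0$. **(2) Upper bound on the computational resolution limit.** If $$d_{\min}^*\ge\frac{4.7(1+d)}{\Omega}\sqrt[2n-2]{\frac{3}{\sigma_{\min}(s^*)}\frac{\sigma}{m_{\min}^*}},$$ then no discrete measure with $k<n$ support points is $(d,\sigma,M)$-admissible for $\mathbf Y$. **(3) Stability of the support.** If $$d_{\min}^*\ge\frac{6.24(1+d)}{\Omega}\sqrt[2n-1]{\frac{3}{\sigma_{\min}(s^*)}\frac{\sigma}{m_{\min}^*}},$$ and $\mu=\sum_{j=1}^na_j\delta_{y_j}$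 with $-\frac d\Omega\le y_1<\dots<y_n\le\frac d\Omega$ is $(d,\sigma,M)$-admissible for $\mathbf Y$, then for $i=1,\dots,n$ $$|y_i-y_i^*|<\frac{d_{\min}^*}{2}\quad\text{and}\quad |y_i-y_i^*|\le\frac{C(n,d)}{\Omega}\Big(\frac{\pi}{\Omega d_{\min}^*}\Big)^{2n-2}\frac{3\sigma}{\sigma_{\min}(s^*)\,m_{\min}^*},$$ where $C(n,d)=\dfrac{7.73\sqrt{4n-1}\,(2n-1)(4+4d)^{2n-1}}{4e\,\pi^{2n-\frac12}}$. **(4) Sharpness.** Let $m^*>0$. There is a $d$ with $$\frac dn=\frac2e\sqrt[2n-1]{\frac{2n-1}{e^{1+d}}}\ \sqrt[2n-1]{\frac{\sigma}{m^*}},$$ and for every such $d$, with $\tau=\frac{d}{n\Omega}$, there are discrete measures $\mu^*$ and $\mu$ with supports $\{-\tau,-2\tau,\dots,-n\tau\}$ and $\{\tau,2\tau,\dots,n\tau\}$, respectively, such that $\|\mu\|_{TV}\le\|\mu^*\|_{TV}=m^*$ and $\sqrt{h/\Omega}\,\|[\mu*f_\Omega]-[\mu^* *f_\Omega]\|_2\le\sigma$.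 -/

import Mathlib

noncomputable section

namespace SuperRes

/-- A discrete measure `∑ j, amp j • δ_(pos j)` on the line, with real amplitudes and `k` distinct
positions, listed in increasing order (so that the representation is unique once all amplitudes
are nonzero). -/
structure DiscreteMeasure (k : ℕ) where
  pos : Fin k → ℝ
  amp : Fin k → ℝ
  pos_strictMono : StrictMono pos

namespace DiscreteMeasure

variable {k : ℕ}

/-- All amplitudes are nonzero, i.e. the support consists of exactly the `k` positions. -/
def FullSupport (μ : DiscreteMeasure k) : Prop := ∀ j, μ.amp j ≠ 0

/-- The measure is supported in `[-D, D]`. -/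
def SupportedIn (μ : DiscreteMeasure k) (D : ℝ) : Prop := ∀ j, μ.pos j ∈ Set.Icc (-D) D

/-- Total variation norm. -/
def tv (μ : DiscreteMeasure k) : ℝ := ∑ j, |μ.amp j|

/-- `m_min = min_j |a_j|`. -/
def mMin (μ : DiscreteMeasure k) : ℝ := ⨅ j, |μ.amp j|

/-- `d_min = min_{i ≠ j} |y_i - y_j|`. -/
def dMin (μ : DiscreteMeasure k) : ℝ :=
  ⨅ p : {p : Fin k × Fin k // p.1 ≠ p.2}, |μ.pos p.1.1 - μ.pos p.1.2|

/-- The convolution `μ * f`. -/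
def conv (μ : DiscreteMeasure k) (f : ℝ → ℝ) (x : ℝ) : ℝ := ∑ j, μ.amp j * f (x - μ.pos j)

/-- The vector `[μ * f]` of values of `μ * f` at the sample points. -/
def image (μ : DiscreteMeasure k) (f : ℝ → ℝ) {N : ℕ} (x : Fin N → ℝ) :
    EuclideanSpace ℂ (Fin N) :=
  WithLp.toLp 2 fun t => ((μ.conv f (x t) : ℝ) : ℂ)

/-- Admissible measures for the image `Y`: interval half-length `D`, noise level `σ`, total
variation bound `M`, sample points `x` with spacing `δ`. -/
def IsAdmissible (μ : DiscreteMeasure k) (f : ℝ → ℝ) {N : ℕ} (x : Fin N → ℝ) (δ D σ M : ℝ)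
    (Y : EuclideanSpace ℂ (Fin N)) : Prop :=
  μ.SupportedIn D ∧ μ.tv ≤ M ∧ √δ * ‖μ.image f x - Y‖ ≤ σ

end DiscreteMeasure

/-- The point spread function with cutoff frequency `Ω`, extended continuously to `0`. -/
def psf (Ω x : ℝ) : ℝ := √Ω * Real.sinc (Ω * x)

theorem psf_eq {Ω x : ℝ} (hΩ : 0 < Ω) (hx : x ≠ 0) :
    psf Ω x = 1 / √Ω * (Real.sin (Ω * x) / x) := by
  have h1 : √Ω ≠ 0 := (Real.sqrt_pos.2 hΩ).ne'
  have h2 : √Ω * √Ω = Ω := Real.mul_self_sqrt hΩ.le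
  rw [psf, Real.sinc_of_ne_zero (mul_ne_zero hΩ.ne' hx)]
  field_simp
  rw [pow_two, h2]

/-- The sample points `-R/Ω, -R/Ω + h/Ω, -R/Ω + 2h/Ω, …`. -/
def samplePoint (Ω R h : ℝ) {N : ℕ} (t : Fin N) : ℝ := -R / Ω + (t : ℝ) * (h / Ω)

/-- The multipole matrix `H(s)`, with columns
`h_r = √(2r+1) (f^(r)(Ω x_1), …, f^(r)(Ω x_N))ᵀ`, `0 ≤ r < s`, where `f(x) = sin x / x`. -/
def multipoleMatrix (Ω : ℝ) {N : ℕ} (x : Fin N → ℝ) (s : ℕ) : Matrix (Fin N) (Fin s) ℝ :=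
  Matrix.of fun t r => √(2 * (r : ℝ) + 1) * iteratedDeriv r Real.sinc (Ω * x t)

/-- The smallest singular value `√(λ_min(Aᵀ A))` of a real matrix with `s` columns. -/
def minSingularValue {N s : ℕ} (A : Matrix (Fin N) (Fin s) ℝ) : ℝ :=
  √(⨅ i, (Matrix.isHermitian_conjTranspose_mul_self A).eigenvalues i)

/-- `σ_min(s) = σ_min(√h H(s))` for the sample points determined by `Ω, R, h, N`. -/
def sigmaMin (Ω R h : ℝ) (N s : ℕ) : ℝ :=
  minSingularValue (√h • multipoleMatrix Ω (samplePoint Ω R h (N := N)) s)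

/-- `s* = min {l ∈ ℕ : d^l / (l! √(2l+1)) ≤ σ / (2 e^d √π M)}`. -/
def sStar (d σ M : ℝ) : ℕ :=
  sInf {l : ℕ | d ^ l / ((l.factorial : ℝ) * √(2 * (l : ℝ) + 1))
    ≤ σ / (2 * Real.exp d * √Real.pi * M)}

/-- The super-resolution factor `π / (Ω d_min)`. -/
def srf (Ω dmin : ℝ) : ℝ := Real.pi / (Ω * dmin)

/-- The constant `C(n, d)` of the stability estimate. -/
def stabConst (n : ℕ) (d : ℝ) : ℝ :=
  7.73 * √(4 * (n : ℝ) - 1) * (2 * (n : ℝ) - 1) * (4 + 4 * d) ^ (2 * n - 1) /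
    (4 * Real.exp 1 * Real.pi ^ (2 * (n : ℝ) - 1 / 2))

/-- The equation that determines the interval size `d` in the lower-bound construction. -/
def LowerEq (n : ℕ) (σ m d : ℝ) : Prop :=
  d / ((n : ℝ) - 1) = 2 / Real.exp 1 *
    ((2 * (n : ℝ) - 2) / Real.exp d) ^ (1 / (2 * (n : ℝ) - 2)) *
    (σ / m) ^ (1 / (2 * (n : ℝ) - 2))

/-- The equation that determines the interval size `d` in the sharpness construction. -/
def SharpEq (n : ℕ) (σ m d : ℝ) : Prop :=
  d / (n : ℝ) = 2 / Real.exp 1 *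
    ((2 * (n : ℝ) - 1) / Real.exp (1 + d)) ^ (1 / (2 * (n : ℝ) - 1)) *
    (σ / m) ^ (1 / (2 * (n : ℝ) - 1))

end SuperRes

end

/-! After rescaling positions by `Ω`, the image of a measure is sampled from `√Ω` times the band
transform of its spectrum `∑ a_j e^{-iwΩy_j}`, `|w| ≤ 1`. Bessel's inequality on a grid of step `h ≤
π` bounds the sampled `ℓ²` norm by the `L²` norm of the spectrum on the band. Two directions follow.

Parts (2), (3): an admissible `μ` and `μ*` have images within `2σ`. Expand the difference of spectra
in powers of `iw`. The terms below order `s*` form `H(s*)` applied to the weighted moment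
differences, and `s*` is the order at which the remainder costs at most `σ`. So `σ_min(s*)` controls
the low moments by `3σ`; the high ones are bounded trivially (`abs_moment_sub_le`). Testing the
moments on a polynomial that vanishes at all atoms of `μ` and all but one atom of `μ*` makes the
product of distances from that atom to the others small (`amp_mul_prod_le`).

The divided difference of a monic polynomial at separated nodes equals one
(`one_le_sum_prod_div_prod`), so a monic polynomial of degree at most `n - 1` cannot be small at all
nodes. For fewer than `n` atoms this is a contradiction (`not_moments_close`). For `n` atoms,
deleting roots gives one root within half a gap of each node, and monotonicity fixes the matching
(`abs_sub_lt_half`); dividing out the other factors gives the rate (`abs_sub_mul_le`).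

Parts (1), (4): on an equispaced grid with `ζ = e^{-iwT}`, amplitudes taken from `(1 - ζ)^{2k}` or
`(1 + ζ)(1 - ζ)^{2k+1}`, with `n = k + 1`, give a spectrum of size `O(|wT|^p)`, `p = 2k` or `2k +
1`. Splitting the coefficients between `μ*` and `μ` makes the images close, again by Bessel, and the
equation for `d` is calibrated to bring the error below `σ`. -/

namespace SuperRes

/-- The samples at `x` of the (real part of the) function with band-limited spectrum `g`. -/
noncomputable def bandTransform (g : ℝ → ℂ) (x : ℝ) : ℝ :=
  (∫ w in (-1 : ℝ)..1, (g w * Complex.exp ((w * x : ℝ) * Complex.I)).re) / 2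

/-! ### Bessel's inequality on the sampling grid -/

section Bessel

open Complex

theorem integral_cos_mul_int {h : ℝ} (hh : 0 < h) (a : ℤ) (ha : a ≠ 0) :
    ∫ w in (-(Real.pi / h))..(Real.pi / h), Real.cos (w * (a * h)) = 0 := by
  have hne : (a : ℝ) * h ≠ 0 := mul_ne_zero (by exact_mod_cast ha) hh.ne'
  rw [intervalIntegral.integral_comp_mul_right (fun w => Real.cos w) hne, integral_cos]
  have e : Real.pi / h * (a * h) = a * Real.pi := by field_simp
  rw [neg_mul, e, Real.sin_neg, Real.sin_int_mul_pi]
  simp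

theorem norm_sq_sum_exp {N : ℕ} (u x : Fin N → ℝ) (w : ℝ) :
    ‖∑ t, (u t : ℂ) * exp ((w * x t : ℝ) * I)‖ ^ 2 =
      ∑ t, ∑ s, u t * u s * Real.cos (w * (x t - x s)) := by
  rw [← Complex.normSq_eq_norm_sq, Complex.normSq_apply, Complex.re_sum, Complex.im_sum]
  simp only [Complex.re_ofReal_mul, Complex.im_ofReal_mul, Complex.exp_ofReal_mul_I_re,
    Complex.exp_ofReal_mul_I_im]
  rw [Finset.sum_mul_sum, Finset.sum_mul_sum, ← Finset.sum_add_distrib]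
  refine Finset.sum_congr rfl fun t _ => ?_
  rw [← Finset.sum_add_distrib]
  refine Finset.sum_congr rfl fun s _ => ?_
  rw [mul_sub, Real.cos_sub]
  ring

/-- The interval is a full period `2π/h` of the frequencies of the grid, so off-diagonal terms
integrate to zero; the offset `-R` cancels in the differences. -/
theorem integral_norm_sq_sum_exp {N : ℕ} (u : Fin N → ℝ) (R : ℝ) {h : ℝ} (hh : 0 < h) :
    ∫ w in (-(Real.pi / h))..(Real.pi / h),
      ‖∑ t : Fin N, (u t : ℂ) * exp ((w * (-R + t * h) : ℝ) * I)‖ ^ 2 =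
      2 * (Real.pi / h) * ∑ t, u t ^ 2 := by
  simp_rw [norm_sq_sum_exp u (fun t : Fin N => -R + t * h)]
  rw [intervalIntegral.integral_finsetSum
    (fun t _ => Continuous.intervalIntegrable (by fun_prop) _ _), Finset.mul_sum]
  refine Finset.sum_congr rfl fun t _ => ?_
  rw [intervalIntegral.integral_finsetSum
    (fun t _ => Continuous.intervalIntegrable (by fun_prop) _ _), Finset.sum_eq_single t]
  · simp
    ring
  · intro s _ hs
    rw [intervalIntegral.integral_const_mul]
    have := integral_cos_mul_int hh ((t : ℤ) - (s : ℤ)) (by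
      intro h0
      apply hs
      ext
      omega)
    have e : ∀ w : ℝ, w * (-R + (t : ℝ) * h - (-R + (s : ℝ) * h)) =
        w * ((((t : ℤ) - (s : ℤ) : ℤ) : ℝ) * h) := by
      intro w
      push_cast
      ring
    simp_rw [e, this, mul_zero]
  · simp

/-- Bessel's inequality for the samples of a band-limited function on a grid of step at most `π`. -/
theorem bessel_bandTransform {N : ℕ} (R : ℝ) {h : ℝ} (hh : 0 < h) (hhπ : h ≤ Real.pi)
    {g : ℝ → ℂ} (hg : Continuous g) :
    h * ∑ t : Fin N, bandTransform g (-R + t * h) ^ 2 ≤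
      Real.pi / 2 * ∫ w in (-1 : ℝ)..1, ‖g w‖ ^ 2 := by
  set u : Fin N → ℝ := fun t => bandTransform g (-R + t * h) with hu
  set L := Real.pi / h with hL
  have hL1 : 1 ≤ L := (one_le_div hh).2 hhπ
  have hL0 : 0 < L := by linarith
  -- Duality: the samples themselves serve as coefficients, so pairing `g` with `T` returns twice
  -- the sum of their squares.
  set T : ℝ → ℂ := fun w => ∑ t : Fin N, (u t : ℂ) * exp ((w * (-R + t * h) : ℝ) * I) with hT
  have hTc : Continuous T := by
    rw [hT]
    fun_prop
  have key : ∑ t, u t ^ 2 = (∫ w in (-1 : ℝ)..1, (g w * T w).re) / 2 := by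
    have : ∀ w, (g w * T w).re =
        ∑ t : Fin N, u t * (g w * exp ((w * (-R + t * h) : ℝ) * I)).re := by
      intro w
      rw [hT]
      simp only [Finset.mul_sum, Complex.re_sum]
      refine Finset.sum_congr rfl fun t _ => ?_
      rw [← Complex.re_ofReal_mul]
      congr 1
      ring
    simp_rw [this]
    rw [intervalIntegral.integral_finsetSum
      (fun t _ => Continuous.intervalIntegrable (by fun_prop) _ _), Finset.sum_div]
    refine Finset.sum_congr rfl fun t _ => ?_
    rw [intervalIntegral.integral_const_mul, pow_two, mul_div_assoc]
    rfl
  -- Young's inequality with weight `L`, chosen so that the `T` term returns one copy of the sum,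
  -- which is then absorbed on the left.
  have b1 : ∫ w in (-1 : ℝ)..1, (g w * T w).re ≤
      ∫ w in (-1 : ℝ)..1, (L / 2 * ‖g w‖ ^ 2 + 1 / (2 * L) * ‖T w‖ ^ 2) := by
    refine intervalIntegral.integral_mono_on (by norm_num)
      (Continuous.intervalIntegrable (by fun_prop) _ _)
      (Continuous.intervalIntegrable (by fun_prop) _ _) fun w _ => ?_
    have h1 : (g w * T w).re ≤ ‖g w‖ * ‖T w‖ := by
      rw [← norm_mul]
      exact Complex.re_le_norm _
    have h2 : L / 2 * ‖g w‖ ^ 2 + 1 / (2 * L) * ‖T w‖ ^ 2 - ‖g w‖ * ‖T w‖ =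
        1 / (2 * L) * (L * ‖g w‖ - ‖T w‖) ^ 2 := by
      field_simp
      ring
    have h3 : 0 ≤ 1 / (2 * L) * (L * ‖g w‖ - ‖T w‖) ^ 2 := by positivity
    linarith
  -- Here `h ≤ π` is needed: the band `[-1, 1]` must fit inside the period `[-L, L]`.
  have b2 : ∫ w in (-1 : ℝ)..1, ‖T w‖ ^ 2 ≤ 2 * L * ∑ t, u t ^ 2 := by
    rw [← integral_norm_sq_sum_exp u R hh]
    refine intervalIntegral.integral_mono_interval (by linarith) (by norm_num) hL1
      (Filter.Eventually.of_forall fun w => by positivity)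
      (Continuous.intervalIntegrable (by fun_prop) _ _)
  rw [intervalIntegral.integral_add (Continuous.intervalIntegrable (by fun_prop) _ _)
    (Continuous.intervalIntegrable (by fun_prop) _ _), intervalIntegral.integral_const_mul,
    intervalIntegral.integral_const_mul] at b1
  have b3 : 1 / (2 * L) * ∫ w in (-1 : ℝ)..1, ‖T w‖ ^ 2 ≤ ∑ t, u t ^ 2 := by
    calc _ ≤ 1 / (2 * L) * (2 * L * ∑ t, u t ^ 2) := by gcongr
      _ = _ := by field_simp
  have b4 : ∑ t, u t ^ 2 ≤ L / 2 * ∫ w in (-1 : ℝ)..1, ‖g w‖ ^ 2 := by linarith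
  calc h * ∑ t, u t ^ 2 ≤ h * (L / 2 * ∫ w in (-1 : ℝ)..1, ‖g w‖ ^ 2) := by gcongr
    _ = _ := by
      rw [hL]
      field_simp

/-- Integrating `w^{2p}` over the band produces the `2p + 1`, the source of `√(2l+1)` in the
definition of `s*`. -/
theorem sqrt_mul_sqrt_sum_bandTransform_le {N : ℕ} (R : ℝ) {h : ℝ} (hh : 0 < h)
    (hhπ : h ≤ Real.pi) {g : ℝ → ℂ} (hg : Continuous g) {C : ℝ} (hC : 0 ≤ C) (p : ℕ)
    (hgC : ∀ w ∈ Set.Icc (-1 : ℝ) 1, ‖g w‖ ≤ C * |w| ^ p) :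
    √h * √(∑ t : Fin N, bandTransform g (-R + t * h) ^ 2) ≤ C * √(Real.pi / (2 * p + 1)) := by
  rw [← Real.sqrt_mul hh.le, ← Real.sqrt_sq hC, ← Real.sqrt_mul (sq_nonneg C)]
  refine Real.sqrt_le_sqrt ((bessel_bandTransform R hh hhπ hg).trans ?_)
  have h1 : ∫ w in (-1 : ℝ)..1, ‖g w‖ ^ 2 ≤ ∫ w in (-1 : ℝ)..1, C ^ 2 * w ^ (2 * p) := by
    refine intervalIntegral.integral_mono_on (by norm_num)
      (Continuous.intervalIntegrable (by fun_prop) _ _)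
      (Continuous.intervalIntegrable (by fun_prop) _ _) fun w hw => ?_
    calc ‖g w‖ ^ 2 ≤ (C * |w| ^ p) ^ 2 := by gcongr; exact hgC w hw
      _ = C ^ 2 * w ^ (2 * p) := by rw [mul_pow, ← pow_mul, mul_comm p 2, pow_mul, sq_abs, ← pow_mul]
  have h2 : ∫ w in (-1 : ℝ)..1, C ^ 2 * w ^ (2 * p) = C ^ 2 * (2 / (2 * p + 1)) := by
    rw [intervalIntegral.integral_const_mul, integral_pow, one_pow,
      Odd.neg_one_pow (by exact ⟨p, rfl⟩)]
    push_cast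
    norm_num
  calc Real.pi / 2 * ∫ w in (-1 : ℝ)..1, ‖g w‖ ^ 2
      ≤ Real.pi / 2 * (C ^ 2 * (2 / (2 * p + 1))) := by
        rw [← h2]
        gcongr
    _ = C ^ 2 * (Real.pi / (2 * p + 1)) := by ring

end Bessel

/-! ### The sinc function and its derivatives as band transforms -/

section Sinc

open Complex

theorem bandTransform_sum {ι : Type*} (s : Finset ι) (a : ι → ℝ) (g : ι → ℝ → ℂ)
    (hg : ∀ i ∈ s, Continuous (g i)) (x : ℝ) :
    bandTransform (fun w => ∑ i ∈ s, (a i : ℂ) * g i w) x =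
      ∑ i ∈ s, a i * bandTransform (g i) x := by
  have hc : ∀ i ∈ s, Continuous fun w : ℝ => a i * (g i w * exp ((w * x : ℝ) * I)).re := by
    intro i hi
    have := hg i hi
    fun_prop
  simp only [bandTransform, Finset.sum_mul, Complex.re_sum, mul_assoc, Complex.re_ofReal_mul]
  rw [intervalIntegral.integral_finsetSum (fun i hi => (hc i hi).intervalIntegrable _ _),
    Finset.sum_div]
  refine Finset.sum_congr rfl fun i _ => ?_
  rw [intervalIntegral.integral_const_mul, mul_div_assoc]

theorem bandTransform_sub {g₁ g₂ : ℝ → ℂ} (h₁ : Continuous g₁) (h₂ : Continuous g₂) (x : ℝ) :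
    bandTransform (fun w => g₁ w - g₂ w) x = bandTransform g₁ x - bandTransform g₂ x := by
  simp only [bandTransform, sub_mul, Complex.sub_re]
  rw [intervalIntegral.integral_sub (Continuous.intervalIntegrable (by fun_prop) _ _)
    (Continuous.intervalIntegrable (by fun_prop) _ _), sub_div]

theorem sinc_eq_bandTransform (x y : ℝ) :
    Real.sinc (x - y) = bandTransform (fun w => exp ((-(w * y) : ℝ) * I)) x := by
  have e : ∀ w : ℝ, (exp ((-(w * y) : ℝ) * I) * exp ((w * x : ℝ) * I)).re =
      Real.cos (w * (x - y)) := by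
    intro w
    rw [← Complex.exp_add, ← add_mul, ← Complex.ofReal_add, Complex.exp_ofReal_mul_I_re]
    congr 1
    ring
  simp_rw [bandTransform, e]
  rcases eq_or_ne (x - y) 0 with h0 | h0
  · simp [h0]
  · rw [intervalIntegral.integral_comp_mul_right (fun w => Real.cos w) h0, integral_cos,
      Real.sinc_of_ne_zero h0]
    simp only [one_mul, neg_mul, Real.sin_neg, smul_eq_mul]
    field_simp
    ring

theorem hasDerivAt_bandTransform {g : ℝ → ℂ} (hg : Continuous g) (x : ℝ) :
    HasDerivAt (bandTransform g) (bandTransform (fun w => (w * I) * g w) x) x := by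
  have key := (intervalIntegral.hasDerivAt_integral_of_dominated_loc_of_deriv_le
    (μ := MeasureTheory.volume) (a := -1) (b := 1) (s := Set.univ) (x₀ := x)
    (F := fun x w => (g w * exp ((w * x : ℝ) * I)).re)
    (F' := fun x w => ((w * I) * g w * exp ((w * x : ℝ) * I)).re)
    (bound := fun w => |w| * ‖g w‖) Filter.univ_mem
    (Filter.Eventually.of_forall fun y => Continuous.aestronglyMeasurable (by fun_prop))
    (Continuous.intervalIntegrable (by fun_prop) _ _)
    (Continuous.aestronglyMeasurable (by fun_prop))
    (Filter.Eventually.of_forall fun w _ y _ => ?_)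
    (Continuous.intervalIntegrable (by fun_prop) _ _)
    (Filter.Eventually.of_forall fun w _ y _ => ?_)).2
  · exact key.div_const 2
  · rw [Real.norm_eq_abs]
    refine (Complex.abs_re_le_norm _).trans ?_
    rw [norm_mul, Complex.norm_exp_ofReal_mul_I, mul_one, norm_mul, norm_mul, Complex.norm_I,
      mul_one, Complex.norm_real, Real.norm_eq_abs]
  · have h1 : HasDerivAt (fun y : ℝ => ((w * y : ℝ) : ℂ) * I) (w * I) y := by
      have : HasDerivAt (fun y : ℝ => ((w * y : ℝ) : ℂ)) ((w * 1 : ℝ) : ℂ) y :=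
        ((hasDerivAt_id y).const_mul w).ofReal_comp
      simpa using this.mul_const I
    have h2 := (h1.cexp.const_mul (g w))
    have h3 := Complex.reCLM.hasFDerivAt.comp_hasDerivAt y h2
    refine HasDerivAt.congr_deriv h3 ?_
    change (_ : ℂ).re = (_ : ℂ).re
    congr 1
    ring

/-- Differentiation under the integral. It identifies the columns of the multipole matrix with
samples of the transforms of `(iw)^r`, the monomials of the Taylor expansion of a spectrum. -/
theorem iteratedDeriv_sinc (r : ℕ) (x : ℝ) :
    iteratedDeriv r Real.sinc x = bandTransform (fun w => (w * I) ^ r) x := by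
  induction r generalizing x with
  | zero =>
    have := sinc_eq_bandTransform x 0
    simpa using this
  | succ r ih =>
    rw [iteratedDeriv_succ, show iteratedDeriv r Real.sinc = _ from funext ih,
      (hasDerivAt_bandTransform (by fun_prop) x).deriv]
    congr 1
    funext w
    ring

end Sinc

/-! ### The exponential tail and the smallest singular value -/

/-- Termwise comparison of the tail with the full series, since `s! m! ≤ (m + s)!`. -/
theorem exp_sub_sum_le {y : ℝ} (hy : 0 ≤ y) (s : ℕ) :
    Real.exp y - ∑ m ∈ Finset.range s, y ^ m / m.factorial ≤
      y ^ s / s.factorial * Real.exp y := by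
  have hs : HasSum (fun m : ℕ => y ^ m / (m.factorial : ℝ)) (Real.exp y) := by
    rw [Real.exp_eq_exp_ℝ]
    exact NormedSpace.expSeries_div_hasSum_exp y
  have h1 := (hasSum_nat_add_iff' s).2 hs
  refine hasSum_le (fun m => ?_) h1 (hs.mul_left (y ^ s / (s.factorial : ℝ)))
  rw [div_mul_div_comm, ← pow_add, add_comm s m]
  have : ((s.factorial * m.factorial : ℕ) : ℝ) ≤ ((m + s).factorial : ℕ) := by
    exact_mod_cast Nat.le_of_dvd (Nat.factorial_pos _)
      (by rw [mul_comm]; exact Nat.factorial_mul_factorial_dvd_factorial_add m s)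
  push_cast at this
  gcongr

/-- Rayleigh quotient: expand in an orthonormal eigenbasis of `Aᵀ A`. -/
theorem minSingularValue_mul_norm_le {N s : ℕ} (A : Matrix (Fin N) (Fin s) ℝ) (θ : Fin s → ℝ) :
    minSingularValue A * √(∑ r, θ r ^ 2) ≤ √(∑ t, (A.mulVec θ) t ^ 2) := by
  have hA := Matrix.isHermitian_conjTranspose_mul_self A
  set lam := ⨅ i, hA.eigenvalues i with hlam
  have hlam0 : 0 ≤ lam := Real.iInf_nonneg fun i =>
    (Matrix.posSemidef_conjTranspose_mul_self A).eigenvalues_nonneg i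
  rw [show minSingularValue A = √lam from rfl, ← Real.sqrt_mul hlam0]
  refine Real.sqrt_le_sqrt ?_
  set B := A.conjTranspose * A with hB
  set b := hA.eigenvectorBasis with hb
  set v : EuclideanSpace ℝ (Fin s) := WithLp.toLp 2 θ with hv
  have hn : ∑ r, θ r ^ 2 = ∑ i, inner ℝ (b i) v ^ 2 := by
    have h1 : ‖v‖ ^ 2 = ∑ r, θ r ^ 2 := by
      rw [EuclideanSpace.real_norm_sq_eq]
    rw [← h1, ← b.sum_sq_norm_inner_right v]
    simp
  have hin : ∀ i, inner ℝ (b i) (WithLp.toLp 2 (B.mulVec θ)) =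
      hA.eigenvalues i * inner ℝ (b i) v := by
    intro i
    have h1 := hA.mulVec_eigenvectorBasis i
    have hBt : B.transpose = B := by simpa [Matrix.IsHermitian] using hA
    simp only [EuclideanSpace.inner_eq_star_dotProduct, star_trivial]
    rw [dotProduct_comm, Matrix.dotProduct_mulVec, ← Matrix.mulVec_transpose, hBt]
    rw [h1, smul_dotProduct, smul_eq_mul, dotProduct_comm]
  have hq : ∑ t, (A.mulVec θ) t ^ 2 = ∑ i, hA.eigenvalues i * inner ℝ (b i) v ^ 2 := by
    have h1 : ∑ t, (A.mulVec θ) t ^ 2 = inner ℝ v (WithLp.toLp 2 (B.mulVec θ)) := by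
      simp only [EuclideanSpace.inner_eq_star_dotProduct, star_trivial, hv, hB]
      rw [← Matrix.mulVec_mulVec, dotProduct_comm, Matrix.dotProduct_mulVec,
        Matrix.conjTranspose_eq_transpose_of_trivial, Matrix.vecMul_transpose]
      simp [dotProduct, pow_two]
    rw [h1, ← b.sum_inner_mul_inner v]
    refine Finset.sum_congr rfl fun i _ => ?_
    rw [hin, real_inner_comm]
    ring
  rw [hn, hq, Finset.mul_sum]
  refine Finset.sum_le_sum fun i _ => ?_
  gcongr
  exact ciInf_le (Set.finite_range _).bddBelow i

end SuperRes

/-! ### Spectra, moments and the moment estimate -/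

namespace SuperRes

namespace DiscreteMeasure

variable {k : ℕ}

/-- The spectrum `∑ j, a_j e^{-i w Ω y_j}` of the rescaled measure. -/
noncomputable def spectrum (μ : DiscreteMeasure k) (Ω w : ℝ) : ℂ :=
  ∑ j, (μ.amp j : ℂ) * Complex.exp ((-(w * (Ω * μ.pos j)) : ℝ) * Complex.I)

/-- The moments `∑ j, a_j (Ω y_j)^r` of the rescaled measure. -/
noncomputable def moment (μ : DiscreteMeasure k) (Ω : ℝ) (r : ℕ) : ℝ :=
  ∑ j, μ.amp j * (Ω * μ.pos j) ^ r

/-- The Taylor polynomial of the spectrum of a measure. -/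
noncomputable def spectrumTaylor (μ : DiscreteMeasure k) (Ω : ℝ) (s : ℕ) (w : ℝ) : ℂ :=
  ∑ r ∈ Finset.range s, (((-1) ^ r * μ.moment Ω r / r.factorial : ℝ) : ℂ) * (w * Complex.I) ^ r

theorem continuous_spectrum (μ : DiscreteMeasure k) (Ω : ℝ) : Continuous (μ.spectrum Ω) := by
  unfold spectrum
  fun_prop

theorem continuous_spectrumTaylor (μ : DiscreteMeasure k) (Ω : ℝ) (s : ℕ) :
    Continuous (μ.spectrumTaylor Ω s) := by
  unfold spectrumTaylor
  fun_prop

theorem abs_scaled_pos_le {μ : DiscreteMeasure k} {Ω d : ℝ} (hΩ : 0 < Ω)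
    (h : μ.SupportedIn (d / Ω)) (j : Fin k) : |Ω * μ.pos j| ≤ d := by
  have := abs_le.2 (h j)
  rw [abs_mul, abs_of_pos hΩ]
  rw [le_div_iff₀ hΩ] at this
  linarith

theorem abs_moment_le {μ : DiscreteMeasure k} {Ω d : ℝ} (hΩ : 0 < Ω)
    (h : μ.SupportedIn (d / Ω)) (r : ℕ) : |μ.moment Ω r| ≤ μ.tv * d ^ r := by
  refine (Finset.abs_sum_le_sum_abs _ _).trans ?_
  rw [tv, Finset.sum_mul]
  refine Finset.sum_le_sum fun j _ => ?_
  rw [abs_mul, abs_pow]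
  gcongr
  exact abs_scaled_pos_le hΩ h j

theorem spectrum_sub_spectrumTaylor (μ : DiscreteMeasure k) (Ω : ℝ) (s : ℕ) (w : ℝ) :
    μ.spectrum Ω w - μ.spectrumTaylor Ω s w =
      ∑ j, (μ.amp j : ℂ) * (Complex.exp ((-(w * (Ω * μ.pos j)) : ℝ) * Complex.I) -
        ∑ r ∈ Finset.range s, (((-(w * (Ω * μ.pos j)) : ℝ) : ℂ) * Complex.I) ^ r / r.factorial) := by
  simp only [mul_sub, Finset.sum_sub_distrib, spectrum, spectrumTaylor]
  congr 1
  simp only [Finset.mul_sum]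
  rw [Finset.sum_comm]
  refine Finset.sum_congr rfl fun r _ => ?_
  simp only [moment]
  push_cast
  rw [Finset.mul_sum, Finset.sum_div, Finset.sum_mul]
  refine Finset.sum_congr rfl fun j _ => ?_
  rw [neg_mul, neg_pow (_ * Complex.I)]
  simp only [mul_pow]
  ring

/-- The exponential tail is applied atom by atom. The factor `|w|^s` is kept because its `L²` norm
supplies the gain `1/√(2s+1)`. -/
theorem norm_spectrum_sub_spectrumTaylor_le {μ : DiscreteMeasure k} {Ω d : ℝ} (hΩ : 0 < Ω)
    (hd : 0 ≤ d) (h : μ.SupportedIn (d / Ω)) (s : ℕ) {w : ℝ} (hw : w ∈ Set.Icc (-1 : ℝ) 1) :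
    ‖μ.spectrum Ω w - μ.spectrumTaylor Ω s w‖ ≤
      μ.tv * (d ^ s / s.factorial * Real.exp d) * |w| ^ s := by
  rw [spectrum_sub_spectrumTaylor, tv, Finset.sum_mul, Finset.sum_mul]
  refine (norm_sum_le _ _).trans (Finset.sum_le_sum fun j _ => ?_)
  rw [norm_mul, Complex.norm_real, Real.norm_eq_abs, mul_assoc]
  refine mul_le_mul_of_nonneg_left ?_ (abs_nonneg _)
  refine (Complex.norm_exp_sub_sum_le_exp_norm_sub_sum _ s).trans ?_
  refine (exp_sub_sum_le (norm_nonneg _) s).trans ?_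
  have hz := abs_scaled_pos_le hΩ h j
  have hw1 : |w| ≤ 1 := abs_le.2 hw
  have e : ‖((-(w * (Ω * μ.pos j)) : ℝ) : ℂ) * Complex.I‖ = |w| * |Ω * μ.pos j| := by
    rw [norm_mul, Complex.norm_I, mul_one, Complex.norm_real, Real.norm_eq_abs, abs_neg, abs_mul]
  rw [e]
  have h1 : |w| * |Ω * μ.pos j| ≤ |w| * d := by gcongr
  have h2 : |w| * |Ω * μ.pos j| ≤ d := h1.trans (by nlinarith [abs_nonneg w])
  calc (|w| * |Ω * μ.pos j|) ^ s / s.factorial * Real.exp (|w| * |Ω * μ.pos j|)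
      ≤ (|w| * d) ^ s / s.factorial * Real.exp d := by gcongr
    _ = _ := by rw [mul_pow]; ring

theorem conv_psf (μ : DiscreteMeasure k) {Ω : ℝ} (hΩ : 0 < Ω) (R h : ℝ) {N : ℕ} (t : Fin N) :
    μ.conv (psf Ω) (samplePoint Ω R h t) =
      √Ω * bandTransform (μ.spectrum Ω) (-R + t * h) := by
  have e := bandTransform_sum Finset.univ μ.amp
    (fun j w => Complex.exp ((-(w * (Ω * μ.pos j)) : ℝ) * Complex.I))
    (fun j _ => by fun_prop) (-R + t * h)
  unfold spectrum
  rw [e, conv, Finset.mul_sum]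
  refine Finset.sum_congr rfl fun j _ => ?_
  rw [← sinc_eq_bandTransform, psf]
  have : Ω * (samplePoint Ω R h t - μ.pos j) = -R + t * h - Ω * μ.pos j := by
    rw [samplePoint]
    field_simp
  rw [this]
  ring

end DiscreteMeasure

open DiscreteMeasure

theorem sqrt_mul_norm_image_sub {k l : ℕ} (μ : DiscreteMeasure k) (ν : DiscreteMeasure l)
    {Ω : ℝ} (hΩ : 0 < Ω) (R : ℝ) {h : ℝ} (hh : 0 < h) (N : ℕ) :
    √(h / Ω) * ‖μ.image (psf Ω) (samplePoint Ω R h (N := N)) -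
        ν.image (psf Ω) (samplePoint Ω R h (N := N))‖ =
      √h * √(∑ t : Fin N,
        bandTransform (fun w => μ.spectrum Ω w - ν.spectrum Ω w) (-R + t * h) ^ 2) := by
  rw [EuclideanSpace.norm_eq, Real.sqrt_div hh.le]
  have : ∀ t : Fin N, ‖(μ.image (psf Ω) (samplePoint Ω R h (N := N)) -
      ν.image (psf Ω) (samplePoint Ω R h (N := N))) t‖ ^ 2 =
      Ω * bandTransform (fun w => μ.spectrum Ω w - ν.spectrum Ω w) (-R + t * h) ^ 2 := by
    intro t
    rw [bandTransform_sub (μ.continuous_spectrum Ω) (ν.continuous_spectrum Ω)]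
    simp only [image, PiLp.sub_apply]
    rw [← Complex.ofReal_sub, Complex.norm_real, Real.norm_eq_abs, sq_abs, conv_psf _ hΩ,
      conv_psf _ hΩ, ← mul_sub, mul_pow, Real.sq_sqrt hΩ.le]
  simp_rw [this]
  rw [← Finset.mul_sum, Real.sqrt_mul hΩ.le]
  have h0 : √Ω ≠ 0 := (Real.sqrt_pos.2 hΩ).ne'
  rw [← mul_assoc, div_mul_cancel₀ _ h0]

theorem sqrt_sum_mul_sq {N : ℕ} {a : ℝ} (ha : 0 ≤ a) (b : Fin N → ℝ) :
    √(∑ t, (a * b t) ^ 2) = a * √(∑ t, b t ^ 2) := by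
  simp_rw [mul_pow]
  rw [← Finset.mul_sum, Real.sqrt_mul (sq_nonneg _), Real.sqrt_sq ha]

theorem sqrt_sum_sub_sq_le {N : ℕ} (a b : Fin N → ℝ) :
    √(∑ t, (a t - b t) ^ 2) ≤ √(∑ t, a t ^ 2) + √(∑ t, b t ^ 2) := by
  have := norm_sub_le (WithLp.toLp 2 a : EuclideanSpace ℝ (Fin N)) (WithLp.toLp 2 b)
  simpa [EuclideanSpace.norm_eq] using this

/-- Factorials beat powers, so the defining set is nonempty and its infimum is attained rather than
being the default `0`. -/
theorem sStar_spec {d σ M : ℝ} (hσ : 0 < σ) (hM : 0 < M) :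
    d ^ sStar d σ M / (((sStar d σ M).factorial : ℝ) * √(2 * (sStar d σ M : ℝ) + 1)) ≤
      σ / (2 * Real.exp d * √Real.pi * M) := by
  have hpos : 0 < σ / (2 * Real.exp d * √Real.pi * M) := by positivity
  have hne : {l : ℕ | d ^ l / ((l.factorial : ℝ) * √(2 * (l : ℝ) + 1))
      ≤ σ / (2 * Real.exp d * √Real.pi * M)}.Nonempty := by
    have ht := FloorSemiring.tendsto_pow_div_factorial_atTop |d|
    obtain ⟨l, hl⟩ := (ht.eventually (gt_mem_nhds hpos)).exists
    refine ⟨l, le_trans ?_ hl.le⟩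
    rw [← div_div]
    have h1 : d ^ l / (l.factorial : ℝ) ≤ |d| ^ l / (l.factorial : ℝ) := by
      refine div_le_div_of_nonneg_right ?_ (Nat.cast_nonneg _)
      rw [← abs_pow]
      exact le_abs_self _
    have h2 : (1 : ℝ) ≤ √(2 * (l : ℝ) + 1) := by
      rw [Real.one_le_sqrt]
      have : (0 : ℝ) ≤ l := Nat.cast_nonneg l
      linarith
    calc d ^ l / (l.factorial : ℝ) / √(2 * (l : ℝ) + 1)
        ≤ |d| ^ l / (l.factorial : ℝ) / √(2 * (l : ℝ) + 1) := by gcongr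
      _ ≤ |d| ^ l / (l.factorial : ℝ) := div_le_self (by positivity) h2
  exact Nat.sInf_mem hne

/-- Dividing the coefficients by `√(2r+1)` undoes the weights of the columns. -/
theorem multipoleMatrix_mulVec {N : ℕ} {Ω : ℝ} (hΩ : 0 < Ω) (R h : ℝ) (s : ℕ) (c : ℕ → ℝ)
    (t : Fin N) :
    (√h • multipoleMatrix Ω (samplePoint Ω R h (N := N)) s).mulVec
        (fun r : Fin s => c r / √(2 * (r : ℝ) + 1)) t =
      √h * bandTransform
        (fun w => ∑ r ∈ Finset.range s, (c r : ℂ) * (w * Complex.I) ^ r) (-R + t * h) := by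
  rw [bandTransform_sum _ _ (fun r w => (w * Complex.I) ^ r) (fun r _ => by fun_prop),
    Matrix.smul_mulVec, Pi.smul_apply, smul_eq_mul, ← Fin.sum_univ_eq_sum_range
      (fun r => c r * bandTransform (fun w => (w * Complex.I) ^ r) (-R + t * h))]
  congr 1
  simp only [Matrix.mulVec, dotProduct, multipoleMatrix, Matrix.of_apply]
  refine Finset.sum_congr rfl fun r _ => ?_
  have e : Ω * samplePoint Ω R h t = -R + t * h := by
    rw [samplePoint]
    field_simp
  have h0 : √(2 * (r : ℝ) + 1) ≠ 0 := (Real.sqrt_pos.2 (by positivity)).ne'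
  rw [e, iteratedDeriv_sinc]
  generalize bandTransform _ _ = b
  field_simp

/-- Test on the first unit vector: its column is the transform of the constant `1`, and Bessel gives
`√π`. -/
theorem sigmaMin_le {Ω : ℝ} (hΩ : 0 < Ω) (R : ℝ) {h : ℝ} (hh : 0 < h) (hhπ : h ≤ Real.pi)
    (N : ℕ) {s : ℕ} (hs : 0 < s) : sigmaMin Ω R h N s ≤ √Real.pi := by
  obtain ⟨s, rfl⟩ : ∃ s', s = s' + 1 := ⟨s - 1, by omega⟩
  have h1 := minSingularValue_mul_norm_le
    (√h • multipoleMatrix Ω (samplePoint Ω R h (N := N)) (s + 1))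
    (fun r : Fin (s + 1) => (fun r : ℕ => if r = 0 then (1 : ℝ) else 0) r / √(2 * (r : ℝ) + 1))
  rw [show (∑ t, _) = _ from Finset.sum_congr rfl fun t _ => congrArg (· ^ 2)
    (multipoleMatrix_mulVec hΩ R h (s + 1) (fun r : ℕ => if r = 0 then (1 : ℝ) else 0) t)] at h1
  rw [sqrt_sum_mul_sq (Real.sqrt_nonneg _)] at h1
  have h2 := sqrt_mul_sqrt_sum_bandTransform_le (N := N) R hh hhπ (C := 1) (g := fun w : ℝ =>
    ∑ r ∈ Finset.range (s + 1), (((if r = 0 then (1 : ℝ) else 0 : ℝ)) : ℂ) * (w * Complex.I) ^ r)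
    (by fun_prop) zero_le_one 0 (fun w _ => by simp [Finset.sum_range_succ'])
  have h3 := h1.trans h2
  simpa [sigmaMin, Fin.sum_univ_succ] using h3

/-- The moments of the difference of two measures with close images are small. -/
theorem abs_moment_sub_le {k l : ℕ} (μ : DiscreteMeasure k) (ν : DiscreteMeasure l)
    {Ω : ℝ} (hΩ : 0 < Ω) {R h : ℝ} (hh : 0 < h) (hhπ : h ≤ Real.pi) {N : ℕ}
    {d σ M : ℝ} (hd : 0 ≤ d) (hσ : 0 < σ) (hM : 0 < M)
    (hμ : μ.SupportedIn (d / Ω)) (hν : ν.SupportedIn (d / Ω)) (hμM : μ.tv ≤ M) (hνM : ν.tv ≤ M)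
    (hclose : √(h / Ω) * ‖μ.image (psf Ω) (samplePoint Ω R h (N := N)) -
        ν.image (psf Ω) (samplePoint Ω R h (N := N))‖ ≤ 2 * σ)
    (hs : 0 < sigmaMin Ω R h N (sStar d σ M)) (r : ℕ) :
    |μ.moment Ω r - ν.moment Ω r| ≤
      3 * σ / sigmaMin Ω R h N (sStar d σ M) * (√(2 * (r : ℝ) + 1) * r.factorial) := by
  set s := sStar d σ M with hsdef
  set S := sigmaMin Ω R h N s with hS
  have hspec := sStar_spec (d := d) hσ hM
  rw [← hsdef] at hspec
  -- An infimum over an empty index type is `0`, so `σ_min(0) = 0` and positivity excludes `s = 0`.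
  have hs0 : 0 < s := by
    rcases Nat.eq_zero_or_pos s with h0 | h0
    · exfalso
      rw [hS, h0] at hs
      simp [sigmaMin, minSingularValue] at hs
    · exact h0
  have hsq : ∀ r : ℕ, 0 < √(2 * (r : ℝ) + 1) := fun r => Real.sqrt_pos.2 (by positivity)
  -- This is the defining inequality of `s*` with its denominators cleared; the `2M` accounts for
  -- two measures.
  have htail : 2 * M * (d ^ s / s.factorial * Real.exp d) * √(Real.pi / (2 * s + 1)) ≤ σ := by
    rw [Real.sqrt_div Real.pi_pos.le]
    have := mul_le_mul_of_nonneg_left hspec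
      (show 0 ≤ 2 * Real.exp d * √Real.pi * M by positivity)
    rw [mul_div_cancel₀ _ (by positivity)] at this
    refine le_trans (le_of_eq ?_) this
    have := (hsq s).ne'
    field_simp
  rcases lt_or_ge r s with hr | hr
  · -- the low order moments are controlled by the smallest singular value
    set c : ℕ → ℝ := fun r => (-1) ^ r * (μ.moment Ω r - ν.moment Ω r) / r.factorial with hc
    have hpoly : ∀ w : ℝ, ∑ r ∈ Finset.range s, (c r : ℂ) * (w * Complex.I) ^ r =
        μ.spectrumTaylor Ω s w - ν.spectrumTaylor Ω s w := by
      intro w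
      rw [spectrumTaylor, spectrumTaylor, ← Finset.sum_sub_distrib]
      refine Finset.sum_congr rfl fun r _ => ?_
      simp only [hc]
      push_cast
      ring
    have h1 := minSingularValue_mul_norm_le
      (√h • multipoleMatrix Ω (samplePoint Ω R h (N := N)) s)
      (fun r : Fin s => c r / √(2 * (r : ℝ) + 1))
    rw [show (∑ t, _) = _ from Finset.sum_congr rfl fun t _ => congrArg (· ^ 2)
      (multipoleMatrix_mulVec hΩ R h s c t)] at h1
    rw [sqrt_sum_mul_sq (Real.sqrt_nonneg _)] at h1
    simp_rw [hpoly] at h1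
    set g₁ : ℝ → ℂ := fun w => μ.spectrum Ω w - ν.spectrum Ω w with hg₁
    set g₂ : ℝ → ℂ := fun w => (μ.spectrum Ω w - μ.spectrumTaylor Ω s w) -
      (ν.spectrum Ω w - ν.spectrumTaylor Ω s w) with hg₂
    have c1 := μ.continuous_spectrum Ω
    have c2 := ν.continuous_spectrum Ω
    have c3 := μ.continuous_spectrumTaylor Ω s
    have c4 := ν.continuous_spectrumTaylor Ω s
    have hg₁c : Continuous g₁ := by fun_prop
    have hg₂c : Continuous g₂ := by fun_prop
    have hsplit : ∀ x, bandTransform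
        (fun w => μ.spectrumTaylor Ω s w - ν.spectrumTaylor Ω s w) x =
        bandTransform g₁ x - bandTransform g₂ x := by
      intro x
      rw [← bandTransform_sub hg₁c hg₂c]
      congr 1
      funext w
      simp only [hg₁, hg₂]
      ring
    simp_rw [hsplit] at h1
    have h2 := sqrt_sum_sub_sq_le (fun t : Fin N => bandTransform g₁ (-R + t * h))
      (fun t : Fin N => bandTransform g₂ (-R + t * h))
    rw [sqrt_mul_norm_image_sub μ ν hΩ R hh N] at hclose
    have h3 := sqrt_mul_sqrt_sum_bandTransform_le (N := N) R hh hhπ hg₂c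
      (C := 2 * M * (d ^ s / s.factorial * Real.exp d)) (by positivity) s (fun w hw => by
        have e1 := norm_spectrum_sub_spectrumTaylor_le hΩ hd hμ s hw
        have e2 := norm_spectrum_sub_spectrumTaylor_le hΩ hd hν s hw
        have e3 : 0 ≤ (d ^ s / s.factorial * Real.exp d) * |w| ^ s := by positivity
        have e4 := norm_sub_le (μ.spectrum Ω w - μ.spectrumTaylor Ω s w)
          (ν.spectrum Ω w - ν.spectrumTaylor Ω s w)
        simp only [mul_assoc] at e1 e2 e3 ⊢
        nlinarith [mul_le_mul_of_nonneg_right hμM e3, mul_le_mul_of_nonneg_right hνM e3])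
    -- The `3σ` is `2σ` from the images plus `σ` from the Taylor remainder.
    have h4 : S * √(∑ r : Fin s, (c r / √(2 * (r : ℝ) + 1)) ^ 2) ≤ 3 * σ := by
      refine h1.trans ((mul_le_mul_of_nonneg_left h2 (Real.sqrt_nonneg h)).trans ?_)
      rw [mul_add]
      linarith
    have h5 : |c r| / √(2 * (r : ℝ) + 1) ≤ √(∑ r : Fin s, (c r / √(2 * (r : ℝ) + 1)) ^ 2) := by
      rw [← abs_of_pos (hsq r), ← abs_div]
      refine Real.abs_le_sqrt ?_
      exact Finset.single_le_sum (f := fun r : Fin s => (c r / √(2 * (r : ℝ) + 1)) ^ 2)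
        (fun i _ => sq_nonneg _) (Finset.mem_univ (⟨r, hr⟩ : Fin s))
    have h6 : |c r| / √(2 * (r : ℝ) + 1) ≤ 3 * σ / S := by
      rw [le_div_iff₀ hs]
      nlinarith
    rw [div_le_iff₀ (hsq r)] at h6
    have h7 : |c r| = |μ.moment Ω r - ν.moment Ω r| / r.factorial := by
      simp only [hc]
      rw [abs_div, abs_mul, abs_pow, abs_neg, abs_one, one_pow, one_mul, Nat.abs_cast]
    rw [h7, div_le_iff₀ (by positivity)] at h6
    linarith
  · -- the high order moments are controlled by the choice of `s`
    obtain ⟨q, rfl⟩ : ∃ q, r = s + q := ⟨r - s, by omega⟩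
    have hSπ : S ≤ √Real.pi := sigmaMin_le hΩ R hh hhπ N hs0
    have h1 : |μ.moment Ω (s + q) - ν.moment Ω (s + q)| ≤ 2 * M * d ^ (s + q) := by
      have e1 := abs_moment_le hΩ hμ (s + q)
      have e2 := abs_moment_le hΩ hν (s + q)
      have e3 : 0 ≤ d ^ (s + q) := by positivity
      have e4 := abs_sub (μ.moment Ω (s + q)) (ν.moment Ω (s + q))
      nlinarith [mul_le_mul_of_nonneg_right hμM e3, mul_le_mul_of_nonneg_right hνM e3]
    -- The `q` extra powers of `d` cost at most `e^d q!`: the `e^d` is the one in the threshold of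
    -- `s*`, and `q!` is absorbed by `(s + q)!`.
    have h2 : d ^ q ≤ Real.exp d * q.factorial := by
      have := Real.pow_div_factorial_le_exp d hd q
      rwa [div_le_iff₀ (by positivity)] at this
    have h3 : (s.factorial : ℝ) * q.factorial ≤ (s + q).factorial := by
      exact_mod_cast Nat.le_of_dvd (Nat.factorial_pos _)
        (Nat.factorial_mul_factorial_dvd_factorial_add s q)
    have h4 : √(2 * (s : ℝ) + 1) ≤ √(2 * ((s + q : ℕ) : ℝ) + 1) := by
      refine Real.sqrt_le_sqrt ?_
      push_cast
      have : (0 : ℝ) ≤ q := Nat.cast_nonneg q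
      linarith
    have h5 : 2 * M * (d ^ s * Real.exp d) * √Real.pi ≤
        σ * (√(2 * (s : ℝ) + 1) * s.factorial) := by
      rw [Real.sqrt_div Real.pi_pos.le] at htail
      have := mul_le_mul_of_nonneg_right htail
        (show 0 ≤ √(2 * (s : ℝ) + 1) * s.factorial by positivity)
      refine le_trans (le_of_eq ?_) this
      have := (hsq s).ne'
      field_simp
    rw [div_mul_eq_mul_div, le_div_iff₀ hs]
    calc |μ.moment Ω (s + q) - ν.moment Ω (s + q)| * S
        ≤ 2 * M * d ^ (s + q) * √Real.pi := by gcongr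
      _ = 2 * M * (d ^ s * d ^ q) * √Real.pi := by rw [pow_add]
      _ ≤ 2 * M * (d ^ s * (Real.exp d * q.factorial)) * √Real.pi := by gcongr
      _ = 2 * M * (d ^ s * Real.exp d) * √Real.pi * q.factorial := by ring
      _ ≤ σ * (√(2 * (s : ℝ) + 1) * s.factorial) * q.factorial := by gcongr
      _ = σ * (√(2 * (s : ℝ) + 1) * (s.factorial * q.factorial)) := by ring
      _ ≤ σ * (√(2 * ((s + q : ℕ) : ℝ) + 1) * (s + q).factorial) := by gcongr
      _ ≤ 3 * σ * (√(2 * ((s + q : ℕ) : ℝ) + 1) * (s + q).factorial) := by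
        gcongr
        linarith

end SuperRes

/-! ### Annihilating polynomials tested against moments -/

namespace SuperRes

open Polynomial in
-- The coefficients of the product are a shift minus a multiple, so the triangle inequality applies.
-- Truncating at a fixed `D` keeps degrees out of the later induction.
theorem sum_abs_coeff_X_sub_C_mul_le (a : ℝ) (q : ℝ[X]) (D : ℕ) :
    ∑ r ∈ Finset.range (D + 1), |((X - C a) * q).coeff r| ≤
      (1 + |a|) * ∑ r ∈ Finset.range (D + 1), |q.coeff r| := by
  have h1 : ∑ r ∈ Finset.range D, |q.coeff r| ≤ ∑ r ∈ Finset.range (D + 1), |q.coeff r| := by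
    rw [Finset.sum_range_succ]
    linarith [abs_nonneg (q.coeff D)]
  have h2 : ∀ r, |((X - C a) * q).coeff (r + 1)| ≤ |q.coeff r| + |a| * |q.coeff (r + 1)| := by
    intro r
    rw [sub_mul, coeff_sub, coeff_X_mul, coeff_C_mul, ← abs_mul]
    exact abs_sub _ _
  have h3 : |((X - C a) * q).coeff 0| = |a| * |q.coeff 0| := by
    rw [sub_mul, coeff_sub, coeff_X_mul_zero, coeff_C_mul, zero_sub, abs_neg, abs_mul]
  have h4 : ∑ r ∈ Finset.range (D + 1), |q.coeff r| =
      ∑ r ∈ Finset.range D, |q.coeff (r + 1)| + |q.coeff 0| := Finset.sum_range_succ' _ _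
  calc ∑ r ∈ Finset.range (D + 1), |((X - C a) * q).coeff r|
      = ∑ r ∈ Finset.range D, |((X - C a) * q).coeff (r + 1)| + |((X - C a) * q).coeff 0| :=
        Finset.sum_range_succ' _ _
    _ ≤ ∑ r ∈ Finset.range D, (|q.coeff r| + |a| * |q.coeff (r + 1)|) + |a| * |q.coeff 0| := by
        rw [h3]
        gcongr
        exact h2 _
    _ = ∑ r ∈ Finset.range D, |q.coeff r| + |a| * ∑ r ∈ Finset.range (D + 1), |q.coeff r| := by
        rw [h4, Finset.sum_add_distrib, ← Finset.mul_sum]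
        ring
    _ ≤ _ := by linarith

open Polynomial in
theorem sum_abs_coeff_prod_mul_le {κ : Type*} (s : Finset κ) (a : κ → ℝ) {d : ℝ}
    (ha : ∀ i ∈ s, |a i| ≤ d) (q : ℝ[X]) (D : ℕ) :
    ∑ r ∈ Finset.range (D + 1), |((∏ i ∈ s, (X - C (a i))) * q).coeff r| ≤
      (1 + d) ^ s.card * ∑ r ∈ Finset.range (D + 1), |q.coeff r| := by
  classical
  induction s using Finset.induction_on with
  | empty => simp
  | insert i s hi ih =>
    rw [Finset.prod_insert hi, mul_assoc, Finset.card_insert_of_notMem hi, pow_succ']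
    have hi' := ha i (Finset.mem_insert_self i s)
    have ih' := ih fun j hj => ha j (Finset.mem_insert_of_mem hj)
    refine (sum_abs_coeff_X_sub_C_mul_le _ _ D).trans ?_
    rw [mul_assoc]
    have : 0 ≤ 1 + d := by linarith [abs_nonneg (a i)]
    gcongr

namespace DiscreteMeasure

open Polynomial in
theorem sum_amp_mul_eval {k : ℕ} (μ : DiscreteMeasure k) (Ω : ℝ) (p : ℝ[X]) {D : ℕ}
    (hp : p.natDegree ≤ D) :
    ∑ j, μ.amp j * p.eval (Ω * μ.pos j) = ∑ r ∈ Finset.range (D + 1), p.coeff r * μ.moment Ω r := by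
  simp only [moment, Finset.mul_sum]
  rw [Finset.sum_comm]
  refine Finset.sum_congr rfl fun j _ => ?_
  rw [eval_eq_sum_range' (Nat.lt_succ_of_le hp), Finset.mul_sum]
  exact Finset.sum_congr rfl fun r _ => by ring

open Polynomial in
/-- If the moments of `μ` and `ν` are close, then every atom of `ν` carries little mass or is close
to the atoms of `μ`. -/
theorem amp_mul_prod_le {k n : ℕ} (μ : DiscreteMeasure k) (ν : DiscreteMeasure n) {Ω B d : ℝ}
    (hd : 0 ≤ d) (hB : 0 ≤ B)
    (hmom : ∀ r : ℕ, |μ.moment Ω r - ν.moment Ω r| ≤ B * (√(2 * (r : ℝ) + 1) * r.factorial))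
    {κ : Type*} [Fintype κ] (z : κ → ℝ) (hz : ∀ q, |z q| ≤ d)
    (hcov : ∀ q, ∃ p, z p = Ω * μ.pos q) (hν : ∀ i, |Ω * ν.pos i| ≤ d) (j : Fin n) {D : ℕ}
    (hD : Fintype.card κ + (n - 1) = D) :
    |ν.amp j| * ((∏ q, |Ω * ν.pos j - z q|) *
        ∏ i ∈ Finset.univ.erase j, |Ω * ν.pos j - Ω * ν.pos i|) ≤
      B * (√(2 * (D : ℝ) + 1) * D.factorial) * (1 + d) ^ D := by
  -- `p` vanishes at every atom of `μ` and at every atom of `ν` except the `j`-th. The trailing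
  -- factor `1` lets the coefficient bound be applied twice.
  set p : ℝ[X] := (∏ q, (X - C (z q))) *
    ((∏ i ∈ Finset.univ.erase j, (X - C (Ω * ν.pos i))) * 1) with hp
  have hcard : (Finset.univ.erase j).card = n - 1 := by
    rw [Finset.card_erase_of_mem (Finset.mem_univ j), Finset.card_univ, Fintype.card_fin]
  have hdeg : p.natDegree ≤ D := by
    rw [hp, mul_one]
    refine natDegree_mul_le.trans ?_
    rw [natDegree_prod_of_monic _ _ fun q _ => monic_X_sub_C _,
      natDegree_prod_of_monic _ _ fun q _ => monic_X_sub_C _]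
    simp only [natDegree_X_sub_C, Finset.sum_const, smul_eq_mul, mul_one, hcard, Finset.card_univ]
    exact hD.le
  have heval : ∀ x, p.eval x = (∏ q, (x - z q)) *
      ∏ i ∈ Finset.univ.erase j, (x - Ω * ν.pos i) := by
    intro x
    rw [hp, mul_one, eval_mul, eval_prod, eval_prod]
    simp
  have h1 : ∑ i, μ.amp i * p.eval (Ω * μ.pos i) = 0 := by
    refine Finset.sum_eq_zero fun i _ => ?_
    obtain ⟨q, hq⟩ := hcov i
    rw [heval, Finset.prod_eq_zero (Finset.mem_univ q) (by rw [hq, sub_self])]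
    ring
  have h2 : ∑ i, ν.amp i * p.eval (Ω * ν.pos i) = ν.amp j * p.eval (Ω * ν.pos j) := by
    refine Finset.sum_eq_single j (fun i _ hi => ?_) (by simp)
    rw [heval, Finset.prod_eq_zero
      (Finset.mem_erase.2 ⟨hi, Finset.mem_univ i⟩ : i ∈ Finset.univ.erase j) (sub_self _)]
    ring
  have h3 : ν.amp j * p.eval (Ω * ν.pos j) =
      -∑ r ∈ Finset.range (D + 1), p.coeff r * (μ.moment Ω r - ν.moment Ω r) := by
    simp only [mul_sub, Finset.sum_sub_distrib]
    rw [← sum_amp_mul_eval _ _ _ hdeg, ← sum_amp_mul_eval _ _ _ hdeg, h1, h2]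
    ring
  have h4 : ∑ r ∈ Finset.range (D + 1), |p.coeff r| ≤ (1 + d) ^ D := by
    have e1 := sum_abs_coeff_prod_mul_le Finset.univ z (fun q _ => hz q)
      ((∏ i ∈ Finset.univ.erase j, (X - C (Ω * ν.pos i))) * 1) D
    have e2 := sum_abs_coeff_prod_mul_le (Finset.univ.erase j) (fun i => Ω * ν.pos i)
      (fun q _ => hν q) 1 D
    have e3 : ∑ r ∈ Finset.range (D + 1), |(1 : ℝ[X]).coeff r| = 1 := by
      rw [Finset.sum_range_succ']
      simp [coeff_one]
    rw [e3, hcard, mul_one ((1 + d) ^ (n - 1))] at e2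
    rw [Finset.card_univ] at e1
    refine e1.trans ((mul_le_mul_of_nonneg_left e2
      (show 0 ≤ (1 + d) ^ Fintype.card κ by positivity)).trans ?_)
    rw [← pow_add, hD]
  rw [← Finset.abs_prod, ← Finset.abs_prod, ← abs_mul, ← abs_mul, ← heval, h3, abs_neg]
  calc |∑ r ∈ Finset.range (D + 1), p.coeff r * (μ.moment Ω r - ν.moment Ω r)|
      ≤ ∑ r ∈ Finset.range (D + 1), |p.coeff r| * (B * (√(2 * (D : ℝ) + 1) * D.factorial)) := by
        refine (Finset.abs_sum_le_sum_abs _ _).trans (Finset.sum_le_sum fun r hr => ?_)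
        rw [abs_mul]
        refine mul_le_mul_of_nonneg_left ((hmom r).trans ?_) (abs_nonneg _)
        have hr' : r ≤ D := Nat.lt_succ_iff.1 (Finset.mem_range.1 hr)
        have hr'' : (r : ℝ) ≤ D := by exact_mod_cast hr'
        have hf : (r.factorial : ℝ) ≤ D.factorial := by exact_mod_cast Nat.factorial_le hr'
        gcongr
    _ = (∑ r ∈ Finset.range (D + 1), |p.coeff r|) *
        (B * (√(2 * (D : ℝ) + 1) * D.factorial)) := by rw [Finset.sum_mul]
    _ ≤ (1 + d) ^ D * (B * (√(2 * (D : ℝ) + 1) * D.factorial)) := by gcongr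
    _ = _ := by ring

end DiscreteMeasure

/-! ### Divided differences, products over separated nodes, binomial bounds -/

open Polynomial in
/-- The divided difference of order `#T` of a monic polynomial of degree `#T` is one. -/
theorem one_le_sum_prod_div_prod {ι κ : Type*} [DecidableEq ι] (s : Finset ι) (v : ι → ℝ)
    (hv : Set.InjOn v s) (T : Finset κ) (z : κ → ℝ) (hcard : s.card = T.card + 1) :
    1 ≤ ∑ i ∈ s, (∏ q ∈ T, |v i - z q|) / ∏ j ∈ s.erase i, |v i - v j| := by
  set P : ℝ[X] := ∏ q ∈ T, (X - C (z q)) with hP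
  have hmonic : P.Monic := monic_prod_of_monic _ _ fun q _ => monic_X_sub_C _
  have hdeg : P.natDegree = T.card := by
    rw [hP, natDegree_prod_of_monic _ _ fun q _ => monic_X_sub_C _]
    simp
  have h := Lagrange.leadingCoeff_eq_sum hv (P := P) (by
    rw [degree_eq_natDegree hmonic.ne_zero, hdeg, hcard]
    norm_cast)
  rw [hmonic.leadingCoeff] at h
  rw [← abs_one (α := ℝ), h]
  refine (Finset.abs_sum_le_sum_abs _ _).trans (le_of_eq ?_)
  refine Finset.sum_congr rfl fun i _ => ?_
  rw [abs_div, Finset.abs_prod, hP, eval_prod, Finset.abs_prod]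
  simp

/-- In truncated subtraction `(i - j) + (j - i)` is `|i - j|`; the two factors collect the indices
to the left and to the right of `j`. -/
theorem prod_erase_dist (c : ℕ → ℝ) {n : ℕ} (j : Fin n) :
    ∏ i ∈ Finset.univ.erase j, c ((i - j : ℕ) + (j - i : ℕ)) =
      (∏ m ∈ Finset.range j, c (m + 1)) * ∏ m ∈ Finset.range (n - 1 - j), c (m + 1) := by
  set F : ℕ → ℝ := fun i => if i = (j : ℕ) then 1 else c ((i - j) + (j - i)) with hF
  have h1 : ∏ i ∈ Finset.univ.erase j, c ((i - j : ℕ) + (j - i : ℕ)) = ∏ i : Fin n, F i := by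
    rw [← Finset.mul_prod_erase Finset.univ (fun i : Fin n => F i) (Finset.mem_univ j)]
    simp only [hF, if_true, one_mul]
    refine Finset.prod_congr rfl fun i hi => ?_
    rw [if_neg fun h => (Finset.mem_erase.1 hi).1 (Fin.ext h)]
  obtain ⟨b, hb⟩ : ∃ b, n = (j + 1) + b := ⟨n - 1 - j, by omega⟩
  have hb' : n - 1 - j = b := by omega
  rw [h1, Fin.prod_univ_eq_prod_range, hb', congrArg Finset.range hb, Finset.prod_range_add,
    Finset.prod_range_succ]
  have h2 : F j = 1 := by simp [hF]
  rw [h2, mul_one, ← Finset.prod_range_reflect]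
  congr 1
  · refine Finset.prod_congr rfl fun m hm => ?_
    have := Finset.mem_range.1 hm
    simp only [hF]
    rw [if_neg (by omega)]
    congr 1
    omega
  · refine Finset.prod_congr rfl fun m _ => ?_
    simp only [hF]
    rw [if_neg (by omega)]
    congr 1
    omega

theorem prod_range_succ_mul (δ : ℝ) (a : ℕ) :
    ∏ m ∈ Finset.range a, (((m + 1 : ℕ) : ℝ) * δ) = a.factorial * δ ^ a := by
  rw [Finset.prod_mul_distrib, Finset.prod_const, Finset.card_range, ← Nat.cast_prod,
    Finset.prod_range_add_one_eq_factorial]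

/-- The half-integer analogue of a factorial, needed when one family of points is displaced by up to
`δ / 2` from the nodes. -/
theorem prod_range_succ_sub_half (δ : ℝ) (a : ℕ) :
    (a.factorial : ℝ) * ∏ m ∈ Finset.range a, ((((m + 1 : ℕ) : ℝ) - 1 / 2) * δ) =
      (2 * a).factorial / 4 ^ a * δ ^ a := by
  induction a with
  | zero => simp
  | succ a ih =>
    rw [Finset.prod_range_succ, Nat.factorial_succ, show 2 * (a + 1) = 2 * a + 1 + 1 by ring,
      Nat.factorial_succ, Nat.factorial_succ]
    push_cast at ih ⊢
    calc _ = ((a : ℝ) + 1) * ((a : ℝ) + 1 - 1 / 2) * δ *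
        ((a.factorial : ℝ) * ∏ m ∈ Finset.range a, (((m : ℝ) + 1 - 1 / 2) * δ)) := by ring
      _ = _ := by rw [ih]; field_simp; ring

theorem factorial_mul_le_prod_erase {n : ℕ} (Z : Fin n → ℝ) {δ : ℝ} (hδ : 0 ≤ δ)
    (hZ : ∀ i j : Fin n, (((i - j : ℕ) + (j - i : ℕ) : ℕ) : ℝ) * δ ≤ |Z i - Z j|) (j : Fin n) :
    ((j : ℕ).factorial * (n - 1 - j).factorial : ℝ) * δ ^ (n - 1) ≤
      ∏ i ∈ Finset.univ.erase j, |Z j - Z i| := by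
  have h := prod_erase_dist (fun m => (m : ℝ) * δ) j
  rw [prod_range_succ_mul, prod_range_succ_mul] at h
  calc ((j : ℕ).factorial * (n - 1 - j).factorial : ℝ) * δ ^ (n - 1)
      = ((j : ℕ).factorial * δ ^ (j : ℕ)) * ((n - 1 - j).factorial * δ ^ (n - 1 - j)) := by
        rw [show n - 1 = j + (n - 1 - j) by omega, pow_add]
        simp only [Nat.add_sub_cancel_left]
        ring
    _ ≤ _ := by
        rw [← h]
        refine Finset.prod_le_prod (fun i _ => by positivity) fun i _ => ?_
        rw [abs_sub_comm]
        exact hZ i j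

/-- Each term is at most `(k.choose j / (k! δ^k))²`, and the squares of a binomial row add up to the
central binomial coefficient. -/
theorem sum_inv_sq_prod_erase_le {k : ℕ} (Z : Fin (k + 1) → ℝ) {δ : ℝ} (hδ : 0 < δ)
    (hZ : ∀ i j : Fin (k + 1), (((i - j : ℕ) + (j - i : ℕ) : ℕ) : ℝ) * δ ≤ |Z i - Z j|) :
    ∑ j, 1 / (∏ i ∈ Finset.univ.erase j, |Z j - Z i|) ^ 2 ≤
      k.centralBinom / (k.factorial ^ 2 * δ ^ (2 * k)) := by
  have h1 : ∀ j : Fin (k + 1), 1 / (∏ i ∈ Finset.univ.erase j, |Z j - Z i|) ^ 2 ≤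
      (fun j : ℕ => ((k.choose j : ℕ) : ℝ) ^ 2) j * (1 / (k.factorial ^ 2 * δ ^ (2 * k))) := by
    intro j
    have h2 := factorial_mul_le_prod_erase Z hδ.le hZ j
    have hj : (j : ℕ) ≤ k := Nat.lt_succ_iff.1 j.2
    simp only [Nat.add_sub_cancel] at h2
    have h3 : ((k.choose j : ℕ) : ℝ) * ((j : ℕ).factorial * (k - j).factorial) = k.factorial := by
      rw [← mul_assoc]
      exact_mod_cast Nat.choose_mul_factorial_mul_factorial hj
    have h4 : ((k.choose j : ℕ) : ℝ) ≠ 0 := by exact_mod_cast (Nat.choose_pos hj).ne'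
    calc 1 / (∏ i ∈ Finset.univ.erase j, |Z j - Z i|) ^ 2
        ≤ 1 / (((j : ℕ).factorial * (k - j).factorial : ℝ) * δ ^ k) ^ 2 := by gcongr
      _ = _ := by
        simp only
        rw [← h3, pow_mul']
        field_simp
  calc _ ≤ ∑ j : Fin (k + 1), (fun j : ℕ => ((k.choose j : ℕ) : ℝ) ^ 2) j *
        (1 / (k.factorial ^ 2 * δ ^ (2 * k))) := Finset.sum_le_sum fun j _ => h1 j
    _ = _ := by
      rw [← Finset.sum_mul, Fin.sum_univ_eq_sum_range (fun j : ℕ => ((k.choose j : ℕ) : ℝ) ^ 2),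
        Nat.centralBinom, ← Nat.sum_range_choose_sq]
      push_cast
      ring

/-- The extra factor `3k + 1` is small enough for the induction to close, and it pays for the
polynomial factors in the two numerical bounds that follow. -/
theorem centralBinom_sq_mul_le (k : ℕ) : k.centralBinom ^ 2 * (3 * k + 1) ≤ 16 ^ k := by
  induction k with
  | zero => simp
  | succ k ih =>
    have h := Nat.succ_mul_centralBinom_succ k
    have h1 : (k + 1) ^ 2 * ((k + 1).centralBinom ^ 2 * (3 * (k + 1) + 1)) ≤
        (k + 1) ^ 2 * 16 ^ (k + 1) := by
      calc (k + 1) ^ 2 * ((k + 1).centralBinom ^ 2 * (3 * (k + 1) + 1))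
          = ((k + 1) * (k + 1).centralBinom) ^ 2 * (3 * (k + 1) + 1) := by ring
        _ = k.centralBinom ^ 2 * (4 * (2 * k + 1) ^ 2 * (3 * k + 4)) := by rw [h]; ring
        _ ≤ k.centralBinom ^ 2 * (16 * (k + 1) ^ 2 * (3 * k + 1)) := by
          refine Nat.mul_le_mul_left _ ?_
          nlinarith
        _ = 16 * (k + 1) ^ 2 * (k.centralBinom ^ 2 * (3 * k + 1)) := by ring
        _ ≤ 16 * (k + 1) ^ 2 * 16 ^ k := by gcongr
        _ = _ := by ring
    exact Nat.le_of_mul_le_mul_left h1 (by positivity)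

theorem sqrt_mul_centralBinom_sq_lt {k : ℕ} (hk : 1 ≤ k) :
    √(4 * (k : ℝ) + 1) * (k.centralBinom : ℝ) ^ 2 < (4.7 : ℝ) ^ (2 * k) := by
  have h1 : (k.centralBinom : ℝ) ^ 2 * (3 * k + 1) ≤ 16 ^ k := by
    exact_mod_cast centralBinom_sq_mul_le k
  have hk0 : (0 : ℝ) ≤ k := Nat.cast_nonneg k
  have h2 : √(4 * (k : ℝ) + 1) ≤ 3 * k + 1 := by
    rw [Real.sqrt_le_left (by positivity)]
    nlinarith
  calc √(4 * (k : ℝ) + 1) * (k.centralBinom : ℝ) ^ 2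
      ≤ (3 * k + 1) * (k.centralBinom : ℝ) ^ 2 := by gcongr
    _ ≤ 16 ^ k := by linarith
    _ < ((4.7 : ℝ) ^ 2) ^ k := pow_lt_pow_left₀ (by norm_num) (by norm_num) (by omega)
    _ = _ := by rw [pow_mul]

/-- With `√(4k+3) ≤ 1.5 · 2^k` the left side is at most `6 · 32^k`, while `6 < 6.24` and `32 <
6.24²`. -/
theorem four_mul_sqrt_mul_centralBinom_sq_lt {k : ℕ} (hk : 1 ≤ k) :
    4 * √(4 * (k : ℝ) + 3) * ((2 * k + 1) * (k.centralBinom : ℝ) ^ 2) <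
      (6.24 : ℝ) ^ (2 * k + 1) := by
  have h1 : (k.centralBinom : ℝ) ^ 2 * (3 * k + 1) ≤ 16 ^ k := by
    exact_mod_cast centralBinom_sq_mul_le k
  have hk1 : (1 : ℝ) ≤ k := by exact_mod_cast hk
  have h2k : ((k : ℝ) + 1) ≤ 2 ^ k := by exact_mod_cast Nat.lt_two_pow_self (n := k)
  have h2 : √(4 * (k : ℝ) + 3) ≤ 1.5 * 2 ^ k := by
    refine le_trans ?_ (mul_le_mul_of_nonneg_left h2k (by norm_num))
    rw [Real.sqrt_le_left (by positivity)]
    nlinarith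
  have h3 : (2 * k + 1) * (k.centralBinom : ℝ) ^ 2 ≤ 16 ^ k := by
    refine le_trans ?_ h1
    rw [mul_comm]
    gcongr
    norm_num
  calc 4 * √(4 * (k : ℝ) + 3) * ((2 * k + 1) * (k.centralBinom : ℝ) ^ 2)
      ≤ 4 * (1.5 * 2 ^ k) * 16 ^ k := by gcongr
    _ = 6 * 32 ^ k := by
      rw [show (32 : ℝ) = 2 * 16 by norm_num, mul_pow]
      ring
    _ < 6.24 * ((6.24 : ℝ) ^ 2) ^ k := by
      have : (32 : ℝ) ^ k ≤ ((6.24 : ℝ) ^ 2) ^ k := by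
        gcongr
        norm_num
      have h0 : (0 : ℝ) < 32 ^ k := by positivity
      linarith
    _ = _ := by rw [pow_succ _ (2 * k), pow_mul, mul_comm]

end SuperRes

/-! ### Matching the roots of a small polynomial with the nodes -/

namespace SuperRes

/-- By Pascal's rule the entry is a sum of two neighbours of the previous row, whose total is `2^K`.
The saved factor `2` reappears in the stability constant. -/
theorem choose_succ_le_two_pow (K r : ℕ) : (K + 1).choose r ≤ 2 ^ K := by
  rcases r with _ | r
  · simpa using Nat.one_le_two_pow
  · rw [Nat.choose_succ_succ, ← Nat.sum_range_choose K]
    rcases lt_or_ge r K with h | h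
    · have hsub : ({r, r + 1} : Finset ℕ) ⊆ Finset.range (K + 1) := by
        intro i hi
        simp only [Finset.mem_insert, Finset.mem_singleton] at hi
        rw [Finset.mem_range]
        omega
      have := Finset.sum_le_sum_of_subset (f := fun i => K.choose i) hsub
      rwa [Finset.sum_pair (by omega)] at this
    · rw [Nat.choose_eq_zero_of_lt (show K < r + 1 by omega), add_zero, Nat.sum_range_choose]
      exact Nat.choose_le_two_pow K r

theorem two_mul_choose_le_four_pow {k : ℕ} (hk : 1 ≤ k) (r : ℕ) :
    2 * (2 * k).choose r ≤ 4 ^ k := by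
  obtain ⟨k, rfl⟩ : ∃ k', k = k' + 1 := ⟨k - 1, by omega⟩
  have := choose_succ_le_two_pow (2 * k + 1) r
  rw [show (4 : ℕ) = 2 ^ 2 by norm_num, ← pow_mul, show 2 * (k + 1) = 2 * k + 1 + 1 by ring,
    pow_succ]
  omega

section Matching

variable {k : ℕ} {Z Zs : Fin (k + 1) → ℝ} {δ E : ℝ}

theorem prod_erase_pos (hδ : 0 < δ)
    (hsep : ∀ i j : Fin (k + 1), (((i - j : ℕ) + (j - i : ℕ) : ℕ) : ℝ) * δ ≤ |Zs i - Zs j|)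
    (j : Fin (k + 1)) : 0 < ∏ i ∈ Finset.univ.erase j, |Zs j - Zs i| :=
  lt_of_lt_of_le (by positivity) (factorial_mul_le_prod_erase Zs hδ.le hsep j)

theorem le_dist_of_ne (hδ : 0 < δ)
    (hsep : ∀ i j : Fin (k + 1), (((i - j : ℕ) + (j - i : ℕ) : ℕ) : ℝ) * δ ≤ |Zs i - Zs j|)
    {i j : Fin (k + 1)} (h : i ≠ j) : δ ≤ |Zs i - Zs j| := by
  refine le_trans ?_ (hsep i j)
  have h1 : 1 ≤ (i - j : ℕ) + (j - i : ℕ) := by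
    have : (i : ℕ) ≠ j := fun h' => h (Fin.ext h')
    omega
  have h2 : (1 : ℝ) ≤ (((i - j : ℕ) + (j - i : ℕ) : ℕ) : ℝ) := by exact_mod_cast h1
  nlinarith

theorem injective_of_sep (hδ : 0 < δ)
    (hsep : ∀ i j : Fin (k + 1), (((i - j : ℕ) + (j - i : ℕ) : ℕ) : ℝ) * δ ≤ |Zs i - Zs j|) :
    Function.Injective Zs := by
  intro i j hij
  by_contra hne
  have := le_dist_of_ne hδ hsep hne
  rw [hij, sub_self, abs_zero] at this
  linarith

/-- The contradiction shared by existence and uniqueness of near roots: each bounds a divided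
difference, equal to one, by this sum. -/
theorem not_one_le_sum (hδ : 0 < δ) (hE0 : 0 ≤ E)
    (hsep : ∀ i j : Fin (k + 1), (((i - j : ℕ) + (j - i : ℕ) : ℕ) : ℝ) * δ ≤ |Zs i - Zs j|)
    (hlt : 4 * E * k.centralBinom < δ * (k.factorial ^ 2 * δ ^ (2 * k))) :
    ¬ 1 ≤ ∑ j, 4 * E / δ * (1 / (∏ i ∈ Finset.univ.erase j, |Zs j - Zs i|) ^ 2) := by
  intro h
  rw [← Finset.mul_sum] at h
  have h1 := mul_le_mul_of_nonneg_left (sum_inv_sq_prod_erase_le Zs hδ hsep)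
    (show 0 ≤ 4 * E / δ by positivity)
  have h2 := h.trans h1
  rw [div_mul_div_comm, one_le_div (by positivity)] at h2
  linarith

/-- If all nodes were far from the root `Z q`, deleting that root would leave a monic polynomial of
degree `k`, too small at the `k + 1` nodes. -/
theorem exists_near (hδ : 0 < δ) (hE0 : 0 ≤ E)
    (hsep : ∀ i j : Fin (k + 1), (((i - j : ℕ) + (j - i : ℕ) : ℕ) : ℝ) * δ ≤ |Zs i - Zs j|)
    (hE : ∀ j, (∏ q, |Zs j - Z q|) * ∏ i ∈ Finset.univ.erase j, |Zs j - Zs i| ≤ E)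
    (hlt : 4 * E * k.centralBinom < δ * (k.factorial ^ 2 * δ ^ (2 * k))) (q : Fin (k + 1)) :
    ∃ j, |Zs j - Z q| < δ / 2 := by
  by_contra! hfar
  refine not_one_le_sum hδ hE0 hsep hlt
    ((one_le_sum_prod_div_prod Finset.univ Zs (injective_of_sep hδ hsep).injOn
      (Finset.univ.erase q) Z (by simp)).trans (Finset.sum_le_sum fun j _ => ?_))
  have hw := prod_erase_pos hδ hsep j
  have hEj := hE j
  rw [← Finset.mul_prod_erase Finset.univ (fun q => |Zs j - Z q|) (Finset.mem_univ q)] at hEj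
  set w := ∏ i ∈ Finset.univ.erase j, |Zs j - Zs i|
  have hP : 0 ≤ ∏ q ∈ Finset.univ.erase q, |Zs j - Z q| :=
    Finset.prod_nonneg fun _ _ => abs_nonneg _
  set P := ∏ q ∈ Finset.univ.erase q, |Zs j - Z q|
  have h1 : δ / 2 * P * w ≤ E := le_trans (by gcongr; exact hfar j) hEj
  have h2 : P * w ≤ 4 * E / δ := by
    rw [le_div_iff₀ hδ]
    nlinarith
  calc P / w = P * w * (1 / w ^ 2) := by field_simp
    _ ≤ 4 * E / δ * (1 / w ^ 2) := by gcongr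

/-- If two roots were near the node `j₁`, delete both roots and the node: a monic polynomial of
degree `k - 1` would be too small at the remaining `k` nodes. -/
theorem near_unique (hδ : 0 < δ) (hE0 : 0 ≤ E)
    (hsep : ∀ i j : Fin (k + 1), (((i - j : ℕ) + (j - i : ℕ) : ℕ) : ℝ) * δ ≤ |Zs i - Zs j|)
    (hE : ∀ j, (∏ q, |Zs j - Z q|) * ∏ i ∈ Finset.univ.erase j, |Zs j - Zs i| ≤ E)
    (hlt : 4 * E * k.centralBinom < δ * (k.factorial ^ 2 * δ ^ (2 * k)))
    {q q' j₁ : Fin (k + 1)} (hq : |Zs j₁ - Z q| < δ / 2) (hq' : |Zs j₁ - Z q'| < δ / 2) :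
    q = q' := by
  by_contra hne
  have hmem : q' ∈ Finset.univ.erase q := Finset.mem_erase.2 ⟨Ne.symm hne, Finset.mem_univ _⟩
  have hcard : (Finset.univ.erase j₁).card = ((Finset.univ.erase q).erase q').card + 1 := by
    rw [Finset.card_erase_add_one hmem]
    simp
  refine not_one_le_sum hδ hE0 hsep hlt
    (((one_le_sum_prod_div_prod (Finset.univ.erase j₁) Zs (injective_of_sep hδ hsep).injOn
      ((Finset.univ.erase q).erase q') Z hcard).trans (Finset.sum_le_sum (g := fun j =>
        4 * E / δ * (1 / (∏ i ∈ Finset.univ.erase j, |Zs j - Zs i|) ^ 2)) fun j hj => ?_)).trans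
      (Finset.sum_le_sum_of_subset_of_nonneg (Finset.erase_subset _ _)
        fun j _ _ => by positivity))
  have hj₁ : j ≠ j₁ := (Finset.mem_erase.1 hj).1
  have hw := prod_erase_pos hδ hsep j
  have hEj := hE j
  have hD := le_dist_of_ne hδ hsep hj₁
  rw [← Finset.mul_prod_erase Finset.univ (fun q => |Zs j - Z q|) (Finset.mem_univ q),
    ← Finset.mul_prod_erase _ (fun q => |Zs j - Z q|) hmem] at hEj
  have hmem' : j₁ ∈ Finset.univ.erase j := Finset.mem_erase.2 ⟨hj₁.symm, Finset.mem_univ _⟩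
  rw [← Finset.mul_prod_erase _ (fun i => |Zs j - Zs i|) hmem'] at hw hEj ⊢
  rw [Finset.erase_right_comm (s := Finset.univ) (a := j) (b := j₁)] at hw hEj ⊢
  have hP : 0 ≤ ∏ q ∈ (Finset.univ.erase q).erase q', |Zs j - Z q| :=
    Finset.prod_nonneg fun _ _ => abs_nonneg _
  set P := ∏ q ∈ (Finset.univ.erase q).erase q', |Zs j - Z q|
  set w := ∏ i ∈ (Finset.univ.erase j₁).erase j, |Zs j - Zs i|
  set D := |Zs j - Zs j₁| with hDdef
  have hD0 : 0 < D := by linarith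
  have hw0 : 0 < w := pos_of_mul_pos_right hw hD0.le
  -- A root near `j₁` is at least half as far from `j` as `j₁` is; two such roots produce the `4` in
  -- `4 * E / δ`.
  have hdist : ∀ p, |Zs j₁ - Z p| < δ / 2 → D / 2 ≤ |Zs j - Z p| := by
    intro p hp
    have := abs_sub_le (Zs j) (Z p) (Zs j₁)
    rw [abs_sub_comm (Z p)] at this
    linarith
  have h1 : D / 2 * (D / 2 * P) * (D * w) ≤ E := by
    refine le_trans ?_ hEj
    have a1 := hdist q hq
    have a2 := hdist q' hq'
    gcongr
  have h2 : P * w * D ^ 2 ≤ 4 * E / δ := by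
    rw [le_div_iff₀ hδ]
    have : P * w * D ^ 2 * δ ≤ P * w * D ^ 2 * D := by gcongr
    nlinarith
  calc P / w = P * w * D ^ 2 * (1 / (D * w) ^ 2) := by field_simp
    _ ≤ 4 * E / δ * (1 / (D * w) ^ 2) := by gcongr

/-- If the monic polynomial with roots `Z` is small at the separated nodes `Zs`, then its roots
are close to the nodes, in order. -/
theorem abs_sub_lt_half (hZ : StrictMono Z) (hZs : StrictMono Zs) (hδ : 0 < δ)
    (hsep : ∀ i j : Fin (k + 1), (((i - j : ℕ) + (j - i : ℕ) : ℕ) : ℝ) * δ ≤ |Zs i - Zs j|)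
    (hE : ∀ j, (∏ q, |Zs j - Z q|) * ∏ i ∈ Finset.univ.erase j, |Zs j - Zs i| ≤ E)
    (hlt : 4 * E * k.centralBinom < δ * (k.factorial ^ 2 * δ ^ (2 * k))) (i : Fin (k + 1)) :
    |Z i - Zs i| < δ / 2 := by
  have hE0 : 0 ≤ E := le_trans (mul_nonneg (Finset.prod_nonneg fun _ _ => abs_nonneg _)
    (Finset.prod_nonneg fun _ _ => abs_nonneg _)) (hE 0)
  choose φ hφ using exists_near hδ hE0 hsep hE hlt
  have hinj : Function.Injective φ := fun q q' h =>
    near_unique hδ hE0 hsep hE hlt (hφ q) (h ▸ hφ q')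
  have hmono : StrictMono φ := by
    intro q q' hqq'
    by_contra hle
    have hlt' : φ q' < φ q := lt_of_le_of_ne (not_lt.1 hle) fun h => hqq'.ne' (hinj h)
    have h1 := le_dist_of_ne hδ hsep hlt'.ne'
    have h2 := hZs hlt'
    rw [abs_of_pos (by linarith)] at h1
    have h3 := abs_lt.1 (hφ q)
    have h4 := abs_lt.1 (hφ q')
    have h5 := hZ hqq'
    linarith [h3.1, h3.2, h4.1, h4.2]
  -- A strictly increasing self-map of a finite chain is the identity.
  have hid : φ = id := hmono.eq_id
  have := hφ i
  rw [hid] at this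
  rwa [abs_sub_comm]

/-- Divide `E` by all factors except `|Z i - Zs i|`. The other roots are at distance at least `(|q -
i| - 1/2) δ`, the other nodes at least `|j - i| δ`; the products combine to `(2i)! (2(k-i))! δ^{2k}
/ 4^k`. -/
theorem abs_sub_mul_le (hδ : 0 < δ)
    (hsep : ∀ i j : Fin (k + 1), (((i - j : ℕ) + (j - i : ℕ) : ℕ) : ℝ) * δ ≤ |Zs i - Zs j|)
    (hE : ∀ j, (∏ q, |Zs j - Z q|) * ∏ i ∈ Finset.univ.erase j, |Zs j - Zs i| ≤ E)
    (hnear : ∀ i, |Z i - Zs i| < δ / 2) (hk : 1 ≤ k) (i : Fin (k + 1)) :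
    |Z i - Zs i| * (2 * (2 * k).factorial * δ ^ (2 * k)) ≤ E * 16 ^ k := by
  have hEi := hE i
  rw [← Finset.mul_prod_erase Finset.univ (fun q => |Zs i - Z q|) (Finset.mem_univ i),
    abs_sub_comm] at hEi
  have hi : (i : ℕ) ≤ k := Nat.lt_succ_iff.1 i.2
  obtain ⟨b, hb⟩ : ∃ b, k = i + b := ⟨k - i, by omega⟩
  have h1 := factorial_mul_le_prod_erase Zs hδ.le hsep i
  have h2 := prod_erase_dist (fun m => ((m : ℝ) - 1 / 2) * δ) i
  have hkb : k + 1 - 1 - (i : ℕ) = b := by omega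
  rw [hkb] at h1 h2
  rw [Nat.add_sub_cancel] at h1
  have h3 : (∏ m ∈ Finset.range i, ((((m + 1 : ℕ) : ℝ) - 1 / 2) * δ)) *
      ∏ m ∈ Finset.range b, ((((m + 1 : ℕ) : ℝ) - 1 / 2) * δ) ≤
      ∏ q ∈ Finset.univ.erase i, |Zs i - Z q| := by
    rw [← h2]
    refine Finset.prod_le_prod (fun q hq => ?_) fun q hq => ?_
    · have hne : (q : ℕ) ≠ i := fun h => (Finset.mem_erase.1 hq).1 (Fin.ext h)
      have : 1 ≤ (q - i : ℕ) + (i - q : ℕ) := by omega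
      have : (1 : ℝ) ≤ (((q - i : ℕ) + (i - q : ℕ) : ℕ) : ℝ) := by exact_mod_cast this
      exact mul_nonneg (by linarith) hδ.le
    · have a1 := hsep q i
      have a2 := hnear q
      have a3 := abs_sub_le (Zs q) (Z q) (Zs i)
      rw [abs_sub_comm (Zs q) (Z q), abs_sub_comm (Z q) (Zs i)] at a3
      linarith
  have e1 := prod_range_succ_sub_half δ i
  have e2 := prod_range_succ_sub_half δ b
  set p₁ := ∏ m ∈ Finset.range i, ((((m + 1 : ℕ) : ℝ) - 1 / 2) * δ)
  set p₂ := ∏ m ∈ Finset.range b, ((((m + 1 : ℕ) : ℝ) - 1 / 2) * δ)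
  have hchoose : ((2 * k).factorial : ℝ) =
      ((2 * k).choose (2 * i) : ℕ) * ((2 * (i : ℕ)).factorial * (2 * b).factorial) := by
    have := Nat.choose_mul_factorial_mul_factorial (show 2 * (i : ℕ) ≤ 2 * k by omega)
    rw [show 2 * k - 2 * (i : ℕ) = 2 * b by omega] at this
    rw [← this]
    push_cast
    ring
  -- This bounds `(2i)! (2b)!` below by `2 (2k)! / 4^k`; with the `4^k` from the half-integers it
  -- gives `16^k`.
  have hc4 : 2 * (((2 * k).choose (2 * i) : ℕ) : ℝ) ≤ 4 ^ k := by
    exact_mod_cast two_mul_choose_le_four_pow hk (2 * i)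
  have hlow : ((2 * (i : ℕ)).factorial * (2 * b).factorial : ℝ) * δ ^ (2 * k) ≤
      4 ^ k * ((∏ q ∈ Finset.univ.erase i, |Zs i - Z q|) *
        ∏ j ∈ Finset.univ.erase i, |Zs i - Zs j|) := by
    have hP : 0 ≤ ∏ q ∈ Finset.univ.erase i, |Zs i - Z q| :=
      Finset.prod_nonneg fun _ _ => abs_nonneg _
    have e3 : ((2 * (i : ℕ)).factorial * (2 * b).factorial : ℝ) * δ ^ (2 * k) =
        4 ^ k * ((p₁ * p₂) * (((i : ℕ).factorial * b.factorial : ℝ) * δ ^ k)) := by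
      calc _ = 4 ^ k * ((((2 * (i : ℕ)).factorial / 4 ^ (i : ℕ) * δ ^ (i : ℕ)) *
            ((2 * b).factorial / 4 ^ b * δ ^ b)) * δ ^ k) := by
            rw [show (4 : ℝ) ^ k = 4 ^ (i : ℕ) * 4 ^ b by rw [← pow_add, ← hb],
              show δ ^ (2 * k) = δ ^ (i : ℕ) * δ ^ b * δ ^ k by
                rw [← pow_add, ← hb, two_mul, pow_add]]
            field_simp
        _ = _ := by rw [← e1, ← e2]; ring
    rw [e3]
    gcongr
  calc |Z i - Zs i| * (2 * (2 * k).factorial * δ ^ (2 * k))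
      = |Z i - Zs i| * (2 * ((2 * k).choose (2 * i) : ℕ) *
        (((2 * (i : ℕ)).factorial * (2 * b).factorial : ℝ) * δ ^ (2 * k))) := by
        rw [hchoose]
        ring
    _ ≤ |Z i - Zs i| * (4 ^ k * (4 ^ k * ((∏ q ∈ Finset.univ.erase i, |Zs i - Z q|) *
        ∏ j ∈ Finset.univ.erase i, |Zs i - Zs j|))) := by gcongr
    _ = (|Z i - Zs i| * (∏ q ∈ Finset.univ.erase i, |Zs i - Z q|) *
        ∏ j ∈ Finset.univ.erase i, |Zs i - Zs j|) * 16 ^ k := by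
        rw [show (16 : ℝ) = 4 * 4 by norm_num, mul_pow]
        ring
    _ ≤ E * 16 ^ k := by gcongr

end Matching

/-! ### Separation and minimal amplitude -/

namespace DiscreteMeasure

variable {n : ℕ}

theorem dMin_le (μ : DiscreteMeasure n) {i j : Fin n} (h : i ≠ j) :
    μ.dMin ≤ |μ.pos i - μ.pos j| :=
  ciInf_le (f := fun p : {p : Fin n × Fin n // p.1 ≠ p.2} => |μ.pos p.1.1 - μ.pos p.1.2|)
    (Set.finite_range _).bddBelow ⟨(i, j), h⟩

theorem add_mul_dMin_le (μ : DiscreteMeasure n) (i : Fin n) (m : ℕ) (h : (i : ℕ) + m < n) :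
    μ.pos i + m * μ.dMin ≤ μ.pos ⟨i + m, h⟩ := by
  induction m with
  | zero => simp
  | succ m ih =>
    have h1 := ih (by omega)
    have hlt : (⟨i + m, by omega⟩ : Fin n) < ⟨i + (m + 1), h⟩ := by
      rw [Fin.lt_def]
      simp
    have h2 := μ.dMin_le hlt.ne'
    rw [abs_of_pos (sub_pos.2 (μ.pos_strictMono hlt))] at h2
    push_cast
    linarith

theorem dist_mul_dMin_le (μ : DiscreteMeasure n) (i j : Fin n) :
    (((i - j : ℕ) + (j - i : ℕ) : ℕ) : ℝ) * μ.dMin ≤ |μ.pos i - μ.pos j| := by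
  have key : ∀ i j : Fin n, i ≤ j → ((j - i : ℕ) : ℝ) * μ.dMin ≤ |μ.pos i - μ.pos j| := by
    intro i j hij
    have h1 := μ.add_mul_dMin_le i (j - i) (by omega)
    have h2 : (⟨i + (j - i), by omega⟩ : Fin n) = j := Fin.ext (by simp; omega)
    rw [h2] at h1
    rw [abs_sub_comm]
    exact le_trans (by linarith) (le_abs_self _)
  rcases le_total i j with h | h
  · rw [show (i - j : ℕ) + (j - i : ℕ) = j - i by omega]
    exact key i j h
  · rw [show (i - j : ℕ) + (j - i : ℕ) = i - j by omega, abs_sub_comm]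
    exact key j i h

theorem scaled_dist_mul_le (μ : DiscreteMeasure n) {Ω : ℝ} (hΩ : 0 < Ω) (i j : Fin n) :
    (((i - j : ℕ) + (j - i : ℕ) : ℕ) : ℝ) * (Ω * μ.dMin) ≤ |Ω * μ.pos i - Ω * μ.pos j| := by
  rw [← mul_sub, abs_mul, abs_of_pos hΩ]
  have := mul_le_mul_of_nonneg_left (μ.dist_mul_dMin_le i j) hΩ.le
  linarith

theorem mMin_le (μ : DiscreteMeasure n) (j : Fin n) : μ.mMin ≤ |μ.amp j| :=
  ciInf_le (f := fun j => |μ.amp j|) (Set.finite_range _).bddBelow j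

theorem mMin_pos {μ : DiscreteMeasure n} (hn : 0 < n) (h : μ.FullSupport) : 0 < μ.mMin := by
  have : Nonempty (Fin n) := ⟨⟨0, hn⟩⟩
  obtain ⟨j, hj⟩ := exists_eq_ciInf_of_finite (f := fun j => |μ.amp j|)
  rw [mMin, ← hj]
  exact abs_pos.2 (h j)

theorem tv_pos {μ : DiscreteMeasure n} (hn : 0 < n) (h : μ.FullSupport) : 0 < μ.tv :=
  lt_of_lt_of_le (mMin_pos hn h) ((μ.mMin_le ⟨0, hn⟩).trans
    (Finset.single_le_sum (f := fun j => |μ.amp j|) (fun _ _ => abs_nonneg _)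
      (Finset.mem_univ _)))

end DiscreteMeasure

/-! ### Resolution and stability from moment bounds -/

open DiscreteMeasure

theorem mul_norm_image_sub_le_two_mul {k n N : ℕ} {Ω h σ : ℝ} (hΩ : 0 < Ω) (hh : 0 < h)
    (f : ℝ → ℝ) (x : Fin N → ℝ) (μ : DiscreteMeasure k) (ν : DiscreteMeasure n)
    {W Y : EuclideanSpace ℂ (Fin N)} (hW : √h * ‖W‖ ≤ σ)
    (hY : Y = ν.image f x + ((√Ω : ℝ) : ℂ) • W) (hμ : √(h / Ω) * ‖μ.image f x - Y‖ ≤ σ) :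
    √(h / Ω) * ‖μ.image f x - ν.image f x‖ ≤ 2 * σ := by
  have e : μ.image f x - ν.image f x = (μ.image f x - Y) + ((√Ω : ℝ) : ℂ) • W := by
    rw [hY]
    abel
  have h1 : ‖((√Ω : ℝ) : ℂ) • W‖ = √Ω * ‖W‖ := by
    rw [norm_smul, Complex.norm_real, Real.norm_eq_abs, abs_of_nonneg (Real.sqrt_nonneg _)]
  have h2 := norm_add_le (μ.image f x - Y) (((√Ω : ℝ) : ℂ) • W)
  rw [← e, h1] at h2
  have h3 : √(h / Ω) * (√Ω * ‖W‖) = √h * ‖W‖ := by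
    rw [← mul_assoc, Real.sqrt_div hh.le, div_mul_cancel₀ _ (Real.sqrt_pos.2 hΩ).ne']
  nlinarith [mul_le_mul_of_nonneg_left h2 (Real.sqrt_nonneg (h / Ω))]

theorem pow_mul_le_of_mul_rpow_le {c x δ e : ℝ} {p : ℕ} (hc : 0 ≤ c) (hx : 0 ≤ x) (hp : p ≠ 0)
    (he : e = (p : ℝ)⁻¹) (h : c * x ^ e ≤ δ) : c ^ p * x ≤ δ ^ p := by
  have h1 := pow_le_pow_left₀ (by positivity) h p
  rwa [he, mul_pow, Real.rpow_inv_natCast_pow hx hp] at h1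

/-- A measure whose atoms are well separated cannot have its moments matched by a measure with
fewer atoms. -/
theorem not_moments_close {k l : ℕ} (hk : 1 ≤ k) (hl : l ≤ k) (μ : DiscreteMeasure l)
    (ν : DiscreteMeasure (k + 1)) {Ω B d : ℝ} (hΩ : 0 < Ω) (hd : 0 ≤ d) (hB : 0 < B)
    (hν : ν.FullSupport) (hμd : ∀ i, |Ω * μ.pos i| ≤ d) (hνd : ∀ i, |Ω * ν.pos i| ≤ d)
    (hsep : (4.7 * (1 + d)) ^ (2 * k) * (B / ν.mMin) ≤ (Ω * ν.dMin) ^ (2 * k))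
    (hdm : 0 < ν.dMin) :
    ¬ ∀ r : ℕ, |μ.moment Ω r - ν.moment Ω r| ≤ B * (√(2 * (r : ℝ) + 1) * r.factorial) := by
  intro hmom
  have hm := mMin_pos (Nat.succ_pos k) hν
  set m := ν.mMin
  set δ := Ω * ν.dMin with hδdef
  have hδ : 0 < δ := by positivity
  have hdist := ν.scaled_dist_mul_le hΩ
  -- Padding the atoms of `μ` with zeros makes the polynomial have degree exactly `k`, as a divided
  -- difference over `k + 1` nodes requires; `0` stays in `[-d, d]`.
  set z : Fin k → ℝ := fun q => if h : (q : ℕ) < l then Ω * μ.pos ⟨q, h⟩ else 0 with hz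
  have hzd : ∀ q, |z q| ≤ d := by
    intro q
    simp only [hz]
    split_ifs
    · exact hμd _
    · simpa using hd
  have hcov : ∀ q, ∃ p, z p = Ω * μ.pos q := by
    intro q
    refine ⟨⟨q, by omega⟩, ?_⟩
    simp [hz]
  have key := fun j => amp_mul_prod_le μ ν hd hB.le hmom z hzd hcov hνd j (D := 2 * k)
    (by simp; omega)
  have h1 := one_le_sum_prod_div_prod Finset.univ (fun i => Ω * ν.pos i)
    (injective_of_sep hδ hdist).injOn Finset.univ z (by simp)
  set K := B * (√(2 * ((2 * k : ℕ) : ℝ) + 1) * (2 * k).factorial) * (1 + d) ^ (2 * k) with hK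
  have h2 : ∀ j, (∏ q, |Ω * ν.pos j - z q|) /
      ∏ i ∈ Finset.univ.erase j, |Ω * ν.pos j - Ω * ν.pos i| ≤
      K / m * (1 / (∏ i ∈ Finset.univ.erase j, |Ω * ν.pos j - Ω * ν.pos i|) ^ 2) := by
    intro j
    have hw := prod_erase_pos (Zs := fun i => Ω * ν.pos i) hδ hdist j
    have hj := key j
    set w := ∏ i ∈ Finset.univ.erase j, |Ω * ν.pos j - Ω * ν.pos i|
    have hP : 0 ≤ ∏ q, |Ω * ν.pos j - z q| := Finset.prod_nonneg fun _ _ => abs_nonneg _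
    set P := ∏ q, |Ω * ν.pos j - z q|
    have h3 : P * w ≤ K / m := by
      rw [le_div_iff₀ hm, mul_comm]
      exact le_trans (by gcongr; exact ν.mMin_le j) hj
    calc P / w = P * w * (1 / w ^ 2) := by field_simp
      _ ≤ _ := by gcongr
  have h3 := h1.trans (Finset.sum_le_sum fun j _ => h2 j)
  rw [← Finset.mul_sum] at h3
  have hK0 : 0 ≤ K / m := by positivity
  have h4 := h3.trans (mul_le_mul_of_nonneg_left (sum_inv_sq_prod_erase_le _ hδ hdist) hK0)
  rw [mul_div_assoc', one_le_div (by positivity)] at h4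
  -- This yields a second central binomial coefficient, hence the square in the numerical bound;
  -- `(k!)²` then cancels.
  have hcb : ((2 * k).factorial : ℝ) = k.centralBinom * (k.factorial) ^ 2 := by
    have := Nat.choose_mul_factorial_mul_factorial (show k ≤ 2 * k by omega)
    rw [show 2 * k - k = k by omega] at this
    rw [← this, Nat.centralBinom]
    push_cast
    ring
  have hnum := sqrt_mul_centralBinom_sq_lt hk
  have h5 : (k.factorial : ℝ) ^ 2 * ((4.7 * (1 + d)) ^ (2 * k) * (B / m)) ≤
      K / m * k.centralBinom := le_trans (by gcongr) h4
  rw [hK, hcb, mul_pow] at h5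
  push_cast at h5
  rw [show 2 * (2 * (k : ℝ)) + 1 = 4 * k + 1 by ring] at h5
  have h6 : 0 < (k.factorial : ℝ) ^ 2 * (1 + d) ^ (2 * k) * (B / m) := by positivity
  have h7 := mul_lt_mul_of_pos_left hnum h6
  refine absurd h5 (not_le.2 (lt_of_le_of_lt (le_of_eq ?_) (lt_of_lt_of_eq h7 ?_)))
  · field_simp
  · ring

/-- Measures with close moments and the same number of well separated atoms have close atoms. -/
theorem atoms_close {k : ℕ} (hk : 1 ≤ k) (μ ν : DiscreteMeasure (k + 1)) {Ω B d : ℝ}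
    (hΩ : 0 < Ω) (hd : 0 ≤ d) (hB : 0 < B)
    (hν : ν.FullSupport) (hμd : ∀ i, |Ω * μ.pos i| ≤ d) (hνd : ∀ i, |Ω * ν.pos i| ≤ d)
    (hsep : (6.24 * (1 + d)) ^ (2 * k + 1) * (B / ν.mMin) ≤ (Ω * ν.dMin) ^ (2 * k + 1))
    (hdm : 0 < ν.dMin)
    (hmom : ∀ r : ℕ, |μ.moment Ω r - ν.moment Ω r| ≤ B * (√(2 * (r : ℝ) + 1) * r.factorial))
    (i : Fin (k + 1)) :
    |Ω * μ.pos i - Ω * ν.pos i| < Ω * ν.dMin / 2 ∧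
      |Ω * μ.pos i - Ω * ν.pos i| * (Ω * ν.dMin) ^ (2 * k) ≤
        B / ν.mMin * √(4 * (k : ℝ) + 3) * (2 * k + 1) * (1 + d) ^ (2 * k + 1) * 16 ^ k / 2 := by
  have hm := mMin_pos (Nat.succ_pos k) hν
  set m := ν.mMin
  set δ := Ω * ν.dMin with hδdef
  have hδ : 0 < δ := by positivity
  have hdist := ν.scaled_dist_mul_le hΩ
  set E := B / m * √(4 * (k : ℝ) + 3) * (2 * k + 1).factorial * (1 + d) ^ (2 * k + 1) with hEdef
  have hE : ∀ j, (∏ q, |Ω * ν.pos j - Ω * μ.pos q|) *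
      ∏ i ∈ Finset.univ.erase j, |Ω * ν.pos j - Ω * ν.pos i| ≤ E := by
    intro j
    have key := amp_mul_prod_le μ ν hd hB.le hmom (fun q => Ω * μ.pos q) hμd
      (fun q => ⟨q, rfl⟩) hνd j (D := 2 * k + 1) (by simp; omega)
    have hP : 0 ≤ (∏ q, |Ω * ν.pos j - Ω * μ.pos q|) *
        ∏ i ∈ Finset.univ.erase j, |Ω * ν.pos j - Ω * ν.pos i| :=
      mul_nonneg (Finset.prod_nonneg fun _ _ => abs_nonneg _)
        (Finset.prod_nonneg fun _ _ => abs_nonneg _)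
    have h1 := (mul_le_mul_of_nonneg_right (ν.mMin_le j) hP).trans key
    rw [← le_div_iff₀' hm] at h1
    refine h1.trans (le_of_eq ?_)
    rw [hEdef]
    push_cast
    rw [show 2 * (2 * (k : ℝ) + 1) + 1 = 4 * k + 3 by ring]
    field_simp
  have hcb : ((2 * k + 1).factorial : ℝ) = (2 * k + 1) * k.centralBinom * (k.factorial) ^ 2 := by
    have := Nat.choose_mul_factorial_mul_factorial (show k ≤ 2 * k by omega)
    rw [show 2 * k - k = k by omega] at this
    rw [Nat.factorial_succ, ← this, Nat.centralBinom]
    push_cast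
    ring
  have hlt : 4 * E * k.centralBinom < δ * (k.factorial ^ 2 * δ ^ (2 * k)) := by
    have hnum := four_mul_sqrt_mul_centralBinom_sq_lt hk
    have h6 : 0 < (k.factorial : ℝ) ^ 2 * (1 + d) ^ (2 * k + 1) * (B / m) := by positivity
    have h7 := mul_lt_mul_of_pos_left hnum h6
    calc 4 * E * k.centralBinom = (k.factorial : ℝ) ^ 2 * (1 + d) ^ (2 * k + 1) * (B / m) *
          (4 * √(4 * (k : ℝ) + 3) * ((2 * k + 1) * (k.centralBinom : ℝ) ^ 2)) := by
          rw [hEdef, hcb]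
          ring
      _ < _ := h7
      _ = (k.factorial : ℝ) ^ 2 * ((6.24 * (1 + d)) ^ (2 * k + 1) * (B / m)) := by
          rw [mul_pow]
          ring
      _ ≤ (k.factorial : ℝ) ^ 2 * δ ^ (2 * k + 1) := by gcongr
      _ = _ := by ring
  have hμmono : StrictMono fun i => Ω * μ.pos i := fun a b hab =>
    mul_lt_mul_of_pos_left (μ.pos_strictMono hab) hΩ
  have hνmono : StrictMono fun i => Ω * ν.pos i := fun a b hab =>
    mul_lt_mul_of_pos_left (ν.pos_strictMono hab) hΩ
  have hnear := abs_sub_lt_half hμmono hνmono hδ hdist hE hlt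
  refine ⟨hnear i, ?_⟩
  have hfin := abs_sub_mul_le hδ hdist hE hnear hk i
  have hf : ((2 * k + 1).factorial : ℝ) = (2 * k + 1) * (2 * k).factorial := by
    rw [Nat.factorial_succ]
    push_cast
    ring
  have hf0 : (0 : ℝ) < 2 * (2 * k).factorial := by positivity
  refine le_of_mul_le_mul_left ?_ hf0
  refine le_trans (le_of_eq ?_) (hfin.trans (le_of_eq ?_))
  · ring
  · rw [hEdef, hf]
    ring

/-- Since `15.46 = 2 · 7.73`, this says that the constant `7.73 / (e π^{3/2})` is at least the `1/2`
coming from the matching. -/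
theorem exp_one_mul_pi_mul_sqrt_pi_le : Real.exp 1 * (Real.pi * √Real.pi) ≤ 15.46 := by
  have h1 : Real.exp 1 ≤ 2.7183 := by linarith [Real.exp_one_lt_d9]
  have h2 : Real.pi ≤ 3.1416 := Real.pi_lt_d4.le
  have h3 : √Real.pi ≤ 1.7726 := by
    rw [Real.sqrt_le_left (by norm_num)]
    linarith
  calc Real.exp 1 * (Real.pi * √Real.pi) ≤ 2.7183 * (3.1416 * 1.7726) := by gcongr
    _ ≤ 15.46 := by norm_num

theorem le_stabConst_mul_srf_pow {k : ℕ} {d Ω D X x : ℝ} (hd : 0 ≤ d) (hΩ : 0 < Ω) (hD : 0 < D)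
    (hX : 0 ≤ X) (h : Ω * x * (Ω * D) ^ (2 * k) ≤
      X * √(4 * (k : ℝ) + 3) * (2 * k + 1) * (1 + d) ^ (2 * k + 1) * 16 ^ k / 2) :
    x ≤ stabConst (k + 1) d / Ω * srf Ω D ^ (2 * (k + 1) - 2) * X := by
  have hpow : Real.pi ^ (2 * ((k + 1 : ℕ) : ℝ) - 1 / 2) =
      Real.pi ^ (2 * k) * (Real.pi * √Real.pi) := by
    rw [show 2 * ((k + 1 : ℕ) : ℝ) - 1 / 2 = ((2 * k + 1 : ℕ) : ℝ) + 1 / 2 by push_cast; ring,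
      Real.rpow_add Real.pi_pos, Real.rpow_natCast, ← Real.sqrt_eq_rpow, pow_succ]
    ring
  have hpi := Real.pi_pos
  have hsp : 0 < √Real.pi := Real.sqrt_pos.2 hpi
  rw [stabConst, srf, hpow, show 2 * (k + 1) - 2 = 2 * k by omega,
    show 2 * (k + 1) - 1 = 2 * k + 1 by omega]
  push_cast
  rw [show 4 * ((k : ℝ) + 1) - 1 = 4 * k + 3 by ring, show 2 * ((k : ℝ) + 1) - 1 = 2 * k + 1 by ring,
    show (4 + 4 * d) = 4 * (1 + d) by ring, mul_pow 4, div_pow,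
    show (4 : ℝ) ^ (2 * k + 1) = 4 * 16 ^ k by
      rw [pow_succ, pow_mul]
      norm_num
      ring]
  have hΩD : 0 < (Ω * D) ^ (2 * k) := by positivity
  set A := X * √(4 * (k : ℝ) + 3) * (2 * k + 1) * (1 + d) ^ (2 * k + 1) * 16 ^ k with hA
  have hA0 : 0 ≤ A := by positivity
  have h1 : x ≤ A / 2 / (Ω * (Ω * D) ^ (2 * k)) := by
    rw [le_div_iff₀ (by positivity)]
    linarith
  have h2 : 1 / 2 ≤ 7.73 / (Real.exp 1 * (Real.pi * √Real.pi)) := by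
    rw [le_div_iff₀ (by positivity)]
    linarith [exp_one_mul_pi_mul_sqrt_pi_le]
  calc x ≤ A / 2 / (Ω * (Ω * D) ^ (2 * k)) := h1
    _ = A / (Ω * (Ω * D) ^ (2 * k)) * (1 / 2) := by ring
    _ ≤ A / (Ω * (Ω * D) ^ (2 * k)) * (7.73 / (Real.exp 1 * (Real.pi * √Real.pi))) := by gcongr
    _ = _ := by
      rw [hA]
      field_simp

end SuperRes

/-! ### Equations for the interval size and grid measures -/

namespace SuperRes

open DiscreteMeasure

/-- Intermediate values on `[0, c F(0)]`: at the right end the linear side equals `F 0`, which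
dominates `F` there. -/
theorem exists_div_eq_of_antitone {F : ℝ → ℝ} (hF : Continuous F) (hanti : Antitone F)
    (h0 : 0 ≤ F 0) {c : ℝ} (hc : 0 < c) : ∃ d, d / c = F d := by
  have hle : (0 : ℝ) ≤ c * F 0 := by positivity
  have hg : ContinuousOn (fun d => d / c - F d) (Set.Icc 0 (c * F 0)) := by fun_prop
  obtain ⟨d, -, hd⟩ := intermediate_value_Icc hle hg
    (show (0 : ℝ) ∈ _ by
      refine ⟨by simpa using h0, ?_⟩
      have : c * F 0 / c = F 0 := by field_simp
      simp only [this, sub_nonneg]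
      exact hanti hle)
  exact ⟨d, by simpa [sub_eq_zero] using hd⟩

theorem exists_div_eq_exp {a b c e x : ℝ} (ha : 0 ≤ a) (hb : 0 < b) (hc : 0 < c) (he : 0 ≤ e)
    (hx : 0 ≤ x) (s : ℝ) : ∃ d, d / c = a * (b / Real.exp (s + d)) ^ e * x ^ e := by
  refine exists_div_eq_of_antitone (F := fun d => a * (b / Real.exp (s + d)) ^ e * x ^ e)
    ?_ ?_ (by positivity) hc
  · have : Continuous fun d => (b / Real.exp (s + d)) ^ e := by
      refine Continuous.rpow_const (continuous_const.div (by fun_prop)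
        fun d => (Real.exp_pos _).ne') fun d => Or.inl ?_
      positivity
    fun_prop
  · intro d d' hdd'
    simp only
    gcongr

theorem mul_norm_image_sub_le {k l N : ℕ} (μ : DiscreteMeasure k) (ν : DiscreteMeasure l)
    {Ω : ℝ} (hΩ : 0 < Ω) (R : ℝ) {h : ℝ} (hh : 0 < h) (hhπ : h ≤ Real.pi) {C : ℝ} (hC : 0 ≤ C)
    (p : ℕ) (hspec : ∀ w, ‖μ.spectrum Ω w - ν.spectrum Ω w‖ ≤ C * |w| ^ p) :
    √(h / Ω) * ‖μ.image (psf Ω) (samplePoint Ω R h (N := N)) -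
        ν.image (psf Ω) (samplePoint Ω R h (N := N))‖ ≤ C * √(Real.pi / (2 * p + 1)) := by
  rw [sqrt_mul_norm_image_sub μ ν hΩ R hh N]
  have c1 := μ.continuous_spectrum Ω
  have c2 := ν.continuous_spectrum Ω
  exact sqrt_mul_sqrt_sum_bandTransform_le R hh hhπ (by fun_prop) hC p fun w _ => hspec w

theorem sqrt_pi_div_le_one {x : ℝ} (hx : 4 ≤ x) : √(Real.pi / x) ≤ 1 := by
  rw [Real.sqrt_le_one, div_le_one (by linarith)]
  exact Real.pi_le_four.trans hx

theorem norm_one_sub_exp_le (x : ℝ) : ‖1 - Complex.exp ((-x : ℝ) * Complex.I)‖ ≤ |x| := by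
  have := Real.norm_exp_I_mul_ofReal_sub_one_le (x := -x)
  rwa [norm_sub_rev, norm_neg, Real.norm_eq_abs, mul_comm] at this

theorem sum_neg_one_pow_choose_mul_pow (n : ℕ) (ζ : ℂ) :
    ∑ i ∈ Finset.range (n + 1), (-1) ^ i * (n.choose i : ℂ) * ζ ^ i = (1 - ζ) ^ n := by
  rw [sub_eq_add_neg, add_comm 1 (-ζ), add_pow]
  refine Finset.sum_congr rfl fun i _ => ?_
  rw [neg_pow ζ, one_pow]
  ring

/-- The binomial identity after `ζ d/dζ`, via the absorption rule for binomial coefficients. -/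
theorem sum_mul_neg_one_pow_choose_mul_pow (n : ℕ) (ζ : ℂ) :
    ∑ i ∈ Finset.range (n + 1 + 1), (i : ℂ) * ((-1) ^ i * ((n + 1).choose i : ℂ) * ζ ^ i) =
      -((n + 1) * ζ * (1 - ζ) ^ n) := by
  rw [Finset.sum_range_succ', ← sum_neg_one_pow_choose_mul_pow n ζ, Finset.mul_sum,
    ← Finset.sum_neg_distrib]
  simp only [Nat.cast_zero, zero_mul, add_zero]
  refine Finset.sum_congr rfl fun i _ => ?_
  have h : ((n + 1 : ℕ) : ℂ) * (n.choose i : ℕ) = ((n + 1).choose (i + 1) : ℕ) * ((i + 1 : ℕ) : ℂ) := by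
    exact_mod_cast Nat.add_one_mul_choose_eq n i
  push_cast at h ⊢
  calc _ = -((((n + 1).choose (i + 1) : ℕ) : ℂ) * (i + 1)) * ((-1) ^ i * ζ ^ i * ζ) := by ring
    _ = _ := by rw [← h]; ring

/-- The equally spaced measure with atoms `(b + j) T / Ω` and amplitudes `a j`. -/
noncomputable def gridMeasure {k : ℕ} (Ω T : ℝ) (hΩ : 0 < Ω) (hT : 0 < T) (b : ℤ)
    (a : ℕ → ℝ) : DiscreteMeasure k where
  pos j := ((b + j : ℤ) : ℝ) * T / Ω
  amp j := a j
  pos_strictMono i j hij := by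
    have : ((b + i : ℤ) : ℝ) < ((b + j : ℤ) : ℝ) := by
      have : (i : ℕ) < j := hij
      exact_mod_cast (by omega : b + (i : ℤ) < b + (j : ℤ))
    exact div_lt_div_of_pos_right (mul_lt_mul_of_pos_right this hT) hΩ

section Grid

variable {k : ℕ} {Ω T : ℝ} (hΩ : 0 < Ω) (hT : 0 < T)

/-- Multiplication by a unimodular power clears the negative exponents when the grid starts to the
left of the origin. -/
theorem gridMeasure_pow_mul_spectrum (b : ℤ) (a : ℕ → ℝ) (p : ℕ) (w : ℝ) (m : ℕ)
    (hm : (p : ℤ) + b = m) :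
    Complex.exp ((-(w * T) : ℝ) * Complex.I) ^ p *
        (gridMeasure (k := k) Ω T hΩ hT b a).spectrum Ω w =
      ∑ j ∈ Finset.range k, (a j : ℂ) * Complex.exp ((-(w * T) : ℝ) * Complex.I) ^ (m + j) := by
  rw [← Fin.sum_univ_eq_sum_range
    (fun j => (a j : ℂ) * Complex.exp ((-(w * T) : ℝ) * Complex.I) ^ (m + j)), DiscreteMeasure.spectrum,
    Finset.mul_sum]
  refine Finset.sum_congr rfl fun j _ => ?_
  rw [mul_left_comm, ← Complex.exp_nat_mul, ← Complex.exp_nat_mul, ← Complex.exp_add]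
  simp only [gridMeasure]
  congr 2
  have e : Ω * (((b + j : ℤ) : ℝ) * T / Ω) = ((b + j : ℤ) : ℝ) * T := by field_simp
  rw [e]
  have hb : (b : ℂ) = (m : ℂ) - p := by
    have : b = (m : ℤ) - p := by omega
    rw [this]
    push_cast
    ring
  push_cast
  rw [hb]
  ring

theorem gridMeasure_tv (b : ℤ) (a : ℕ → ℝ) :
    (gridMeasure (k := k) Ω T hΩ hT b a).tv = ∑ j ∈ Finset.range k, |a j| := by
  rw [← Fin.sum_univ_eq_sum_range (fun j => |a j|)]
  rfl

theorem gridMeasure_supportedIn {d : ℝ} (b : ℤ) (a : ℕ → ℝ) (h1 : -d ≤ b * T)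
    (h2 : (b + k - 1) * T ≤ d) :
    (gridMeasure (k := k) Ω T hΩ hT b a).SupportedIn (d / Ω) := by
  intro j
  have hj : ((j : ℕ) : ℝ) ≤ k - 1 := by
    have : (j : ℕ) + 1 ≤ k := j.2
    have : (((j : ℕ) + 1 : ℕ) : ℝ) ≤ k := by exact_mod_cast this
    push_cast at this
    linarith
  have hj0 : (0 : ℝ) ≤ (j : ℕ) := Nat.cast_nonneg _
  simp only [gridMeasure, Set.mem_Icc]
  push_cast
  rw [← neg_div]
  constructor
  · gcongr
    nlinarith
  · gcongr
    nlinarith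

theorem gridMeasure_dMin (hk : 1 ≤ k) (b : ℤ) (a : ℕ → ℝ) :
    (gridMeasure (k := k + 1) Ω T hΩ hT b a).dMin = T / Ω := by
  have hp : ∀ i j : Fin (k + 1), (gridMeasure (k := k + 1) Ω T hΩ hT b a).pos i -
      (gridMeasure (k := k + 1) Ω T hΩ hT b a).pos j = ((i : ℤ) - (j : ℤ) : ℤ) * (T / Ω) := by
    intro i j
    simp only [gridMeasure]
    push_cast
    ring
  have hTΩ : 0 < T / Ω := by positivity
  have hne : (⟨1, by omega⟩ : Fin (k + 1)) ≠ ⟨0, by omega⟩ := by simp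
  have : Nonempty {p : Fin (k + 1) × Fin (k + 1) // p.1 ≠ p.2} := ⟨⟨(_, _), hne⟩⟩
  refine le_antisymm ?_ (le_ciInf fun p => ?_)
  · have := dMin_le (gridMeasure (k := k + 1) Ω T hΩ hT b a) hne
    rw [hp] at this
    simpa [abs_of_pos hTΩ] using this
  · rw [hp, abs_mul, abs_of_pos hTΩ]
    have h1 : (1 : ℤ) ≤ |((p.1.1 : ℕ) : ℤ) - ((p.1.2 : ℕ) : ℤ)| := by
      refine Int.one_le_abs fun h => p.2 (Fin.ext ?_)
      omega
    have h3 : (1 : ℝ) ≤ |((((p.1.1 : ℕ) : ℤ) - ((p.1.2 : ℕ) : ℤ) : ℤ) : ℝ)| := by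
      exact_mod_cast h1
    nlinarith

end Grid

/-! ### Binomial sums for the total variations -/

theorem sum_choose_lower_eq (k : ℕ) :
    ∑ j ∈ Finset.range k, (2 * k).choose j = ∑ j ∈ Finset.range k, (2 * k).choose (k + (j + 1)) := by
  rw [← Finset.sum_range_reflect]
  refine Finset.sum_congr rfl fun j hj => ?_
  have := Finset.mem_range.1 hj
  rw [← Nat.choose_symm (by omega)]
  congr 1
  omega

theorem sum_choose_lower_le (k : ℕ) :
    ∑ j ∈ Finset.range k, (2 * k).choose j ≤
      ∑ j ∈ Finset.range (k + 1), (2 * k).choose (k + j) := by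
  rw [sum_choose_lower_eq, Finset.sum_range_succ']
  omega

theorem four_pow_le_two_mul_sum_choose (k : ℕ) :
    4 ^ k ≤ 2 * ∑ j ∈ Finset.range (k + 1), (2 * k).choose (k + j) := by
  have h1 := Nat.sum_range_choose (2 * k)
  rw [show 2 * k + 1 = k + (k + 1) by ring, Finset.sum_range_add, pow_mul] at h1
  have h2 := sum_choose_lower_le k
  norm_num at h1
  omega

/-- Telescoping: each summand is `k + 1` times a difference of consecutive entries of row `2k + 1`.
-/
theorem sum_mul_choose_upper (k l : ℕ) :
    ∑ j ∈ Finset.range l, (j + 1) * (2 * k + 2).choose (k + 2 + j) + (k + 1) *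
      (2 * k + 1).choose (k + 1 + l) = (k + 1) * (2 * k + 1).choose (k + 1) := by
  induction l with
  | zero => simp
  | succ l ih =>
    rw [Finset.sum_range_succ, ← ih]
    have h1 : (2 * k + 2).choose (k + 2 + l) =
        (2 * k + 1).choose (k + 1 + l) + (2 * k + 1).choose (k + 1 + l + 1) := by
      rw [show k + 2 + l = (k + 1 + l) + 1 by ring]
      exact Nat.choose_succ_succ _ _
    have h2 := Nat.choose_succ_right_eq (2 * k + 1) (k + 1 + l)
    rw [h1, show k + 1 + (l + 1) = k + 1 + l + 1 by ring]
    set A := (2 * k + 1).choose (k + 1 + l) with hA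
    set B := (2 * k + 1).choose (k + 1 + l + 1)
    rcases le_or_gt l k with hl | hl
    · obtain ⟨c, rfl⟩ : ∃ c, k = l + c := ⟨k - l, by omega⟩
      rw [show 2 * (l + c) + 1 - (l + c + 1 + l) = c by omega] at h2
      nlinarith
    · have hA0 : A = 0 := Nat.choose_eq_zero_of_lt (by omega)
      have hB0 : B = 0 := Nat.choose_eq_zero_of_lt (by omega)
      rw [hA0, hB0]
      ring

theorem sum_mul_choose_eq (k : ℕ) :
    ∑ j ∈ Finset.range (k + 1), (j + 1) * (2 * k + 2).choose (k + 2 + j) =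
      (k + 1) * (2 * k + 1).choose (k + 1) := by
  have := sum_mul_choose_upper k (k + 1)
  rwa [Nat.choose_eq_zero_of_lt (by omega), mul_zero, add_zero] at this

theorem sum_mul_choose_reflect (k : ℕ) :
    ∑ j ∈ Finset.range (k + 1), (k + 1 - j) * (2 * k + 2).choose j =
      ∑ j ∈ Finset.range (k + 1), (j + 1) * (2 * k + 2).choose (k + 2 + j) := by
  rw [← Finset.sum_range_reflect]
  refine Finset.sum_congr rfl fun j hj => ?_
  have := Finset.mem_range.1 hj
  rw [← Nat.choose_symm (by omega)]
  congr 2 <;> omega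

theorem four_pow_le_mul_choose (k : ℕ) :
    4 ^ (k + 1) ≤ 4 * (k + 1) * (2 * k + 1).choose (k + 1) := by
  have h := Nat.four_pow_le_two_mul_self_mul_centralBinom (k + 1) (by omega)
  have h1 : (k + 1).centralBinom = 2 * (2 * k + 1).choose (k + 1) := by
    rw [Nat.centralBinom, show 2 * (k + 1) = 2 * k + 1 + 1 by ring, Nat.choose_succ_succ,
      ← Nat.choose_symm_half k]
    ring
  rw [h1] at h
  nlinarith

end SuperRes

/-! ### Pairs of measures with matching moments -/

namespace SuperRes

open DiscreteMeasure

theorem eight_mul_sq_le_seven_pow {n : ℕ} (hn : 2 ≤ n) : 8 * n ^ 2 ≤ 7 ^ n := by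
  induction n, hn using Nat.le_induction with
  | base => norm_num
  | succ n hn ih =>
    rw [pow_succ 7]
    nlinarith

theorem eight_mul_sq_le_exp {n : ℕ} (hn : 2 ≤ n) : 8 * (n : ℝ) ^ 2 ≤ Real.exp (2 * n) := by
  have h1 : 8 * (n : ℝ) ^ 2 ≤ 7 ^ n := by exact_mod_cast eight_mul_sq_le_seven_pow hn
  have h2 : (7 : ℝ) ≤ Real.exp 1 ^ 2 := by nlinarith [Real.exp_one_gt_d9]
  refine h1.trans ((pow_le_pow_left₀ (by norm_num) h2 n).trans (le_of_eq ?_))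
  rw [← pow_mul, ← Real.exp_nat_mul]
  push_cast
  ring_nf

theorem four_mul_le_exp (k : ℕ) : 4 * (k : ℝ) ≤ Real.exp (2 * k) := by
  have h := Real.quadratic_le_exp_of_nonneg (show (0 : ℝ) ≤ 2 * k by positivity)
  nlinarith [sq_nonneg ((k : ℝ) - 1 / 2), sq_nonneg (k : ℝ)]

theorem pow_eq_of_eq_mul_rpow {t a x y e : ℝ} {p : ℕ} (hp : p ≠ 0) (hx : 0 ≤ x) (hy : 0 ≤ y)
    (he : e = (p : ℝ)⁻¹) (h : t = a * x ^ e * y ^ e) : t ^ p = a ^ p * x * y := by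
  rw [h, he, mul_pow, mul_pow, Real.rpow_inv_natCast_pow hx hp, Real.rpow_inv_natCast_pow hy hp]

theorem exp_pow_eq (k : ℕ) : Real.exp 1 ^ k = Real.exp k := by
  rw [← Real.exp_nat_mul, mul_one]

/-- Two measures, with `k + 1` and `k` atoms on a grid of step `T / Ω`, whose difference has
vanishing moments of order less than `2 k`. -/
theorem exists_close_of_fewer_atoms {k : ℕ} (hk : 1 ≤ k) {Ω T m : ℝ} (hΩ : 0 < Ω) (hT : 0 < T)
    (hm : 0 < m) :
    ∃ (μs : DiscreteMeasure (k + 1)) (μ : DiscreteMeasure k),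
      μs.FullSupport ∧ μ.FullSupport ∧ μs.SupportedIn (k * T / Ω) ∧ μ.SupportedIn (k * T / Ω) ∧
      μ.tv ≤ μs.tv ∧ μs.tv = m ∧ μs.dMin = T / Ω ∧
      ∀ w, ‖μ.spectrum Ω w - μs.spectrum Ω w‖ ≤ 2 * m / 4 ^ k * T ^ (2 * k) * |w| ^ (2 * k) := by
  set A : ℝ := ((∑ j ∈ Finset.range (k + 1), (2 * k).choose (k + j) : ℕ) : ℝ) with hA
  have hA4 : (4 : ℝ) ^ k ≤ 2 * A := by
    rw [hA]
    exact_mod_cast four_pow_le_two_mul_sum_choose k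
  have h4 : (0 : ℝ) < 4 ^ k := by positivity
  have hA0 : 0 < A := by linarith
  set c := m / A with hc
  have hc0 : 0 < c := by positivity
  -- Up to sign and a shift, the coefficients of `c (1 - ζ)^{2k}`: the upper `k + 1` go to `μ*`, the
  -- lower `k`, negated, to `μ`. The scale `c` gives `μ*` total variation `m`.
  set a : ℕ → ℝ := fun j => c * ((-1) ^ j * ((2 * k).choose (k + j) : ℕ)) with ha
  set b : ℕ → ℝ := fun j => -(c * ((-1) ^ k * (-1) ^ j * ((2 * k).choose j : ℕ))) with hb
  have habs : ∀ j, |a j| = c * ((2 * k).choose (k + j) : ℕ) := by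
    intro j
    simp [ha, abs_mul, abs_of_pos hc0]
  have hbbs : ∀ j, |b j| = c * ((2 * k).choose j : ℕ) := by
    intro j
    simp [hb, abs_mul, abs_of_pos hc0]
  have hkT : 0 ≤ k * T := by positivity
  have htvs : ∑ j ∈ Finset.range (k + 1), |a j| = m := by
    simp_rw [habs]
    rw [← Finset.mul_sum, ← Nat.cast_sum, ← hA, hc]
    field_simp
  refine ⟨gridMeasure Ω T hΩ hT 0 a, gridMeasure Ω T hΩ hT (-k) b, ?_, ?_, ?_, ?_, ?_, ?_,
    gridMeasure_dMin hΩ hT hk _ _, ?_⟩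
  · intro j
    rw [← abs_pos]
    change 0 < |a j|
    rw [habs]
    have := Nat.choose_pos (show k + (j : ℕ) ≤ 2 * k by omega)
    positivity
  · intro j
    rw [← abs_pos]
    change 0 < |b j|
    rw [hbbs]
    have := Nat.choose_pos (show (j : ℕ) ≤ 2 * k by omega)
    positivity
  · refine gridMeasure_supportedIn hΩ hT _ _ ?_ ?_
    · push_cast
      linarith
    · push_cast
      linarith
  · refine gridMeasure_supportedIn hΩ hT _ _ ?_ ?_
    · push_cast
      linarith
    · push_cast
      nlinarith
  · rw [gridMeasure_tv, gridMeasure_tv]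
    simp_rw [habs, hbbs]
    rw [← Finset.mul_sum, ← Finset.mul_sum]
    gcongr
    exact_mod_cast sum_choose_lower_le k
  · rw [gridMeasure_tv, htvs]
  · intro w
    set ζ := Complex.exp ((-(w * T) : ℝ) * Complex.I) with hζ
    have hζ1 : ‖ζ‖ = 1 := Complex.norm_exp_ofReal_mul_I _
    have e1 := gridMeasure_pow_mul_spectrum (k := k + 1) hΩ hT 0 a k w k (by simp)
    have e2 := gridMeasure_pow_mul_spectrum (k := k) hΩ hT (-k) b k w 0 (by simp)
    rw [← hζ] at e1 e2
    have e3 : ζ ^ k * ((gridMeasure (k := k) Ω T hΩ hT (-k) b).spectrum Ω w -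
        (gridMeasure (k := k + 1) Ω T hΩ hT 0 a).spectrum Ω w) =
        -(c * (-1) ^ k * (1 - ζ) ^ (2 * k)) := by
      rw [mul_sub, e1, e2, ← sum_neg_one_pow_choose_mul_pow, show 2 * k + 1 = k + (k + 1) by ring,
        Finset.sum_range_add _ k (k + 1), mul_add, Finset.mul_sum, Finset.mul_sum, neg_add, ← sub_eq_add_neg,
        ← Finset.sum_neg_distrib]
      congr 1
      · refine Finset.sum_congr rfl fun j _ => ?_
        simp only [hb, zero_add]
        push_cast
        ring
      · refine Finset.sum_congr rfl fun j _ => ?_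
        simp only [ha]
        push_cast
        have : ((-1 : ℂ)) ^ k * (-1) ^ (k + j) = (-1) ^ j := by
          rw [pow_add, ← mul_assoc, ← pow_add, Even.neg_one_pow ⟨k, rfl⟩, one_mul]
        linear_combination -(c : ℂ) * ((2 * k).choose (k + j) : ℂ) * ζ ^ (k + j) * this
    have e4 := congrArg norm e3
    rw [norm_mul, norm_pow, hζ1, one_pow, one_mul, norm_neg, norm_mul, norm_mul, norm_pow,
      norm_pow, norm_neg, norm_one, one_pow, mul_one, Complex.norm_real, Real.norm_eq_abs,
      abs_of_pos hc0] at e4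
    rw [e4]
    have e5 := norm_one_sub_exp_le (w * T)
    rw [← hζ, abs_mul, abs_of_pos hT] at e5
    have e6 : c ≤ 2 * m / 4 ^ k := by
      rw [hc, div_le_div_iff₀ hA0 h4]
      nlinarith
    calc c * ‖1 - ζ‖ ^ (2 * k) ≤ 2 * m / 4 ^ k * (|w| * T) ^ (2 * k) := by gcongr
      _ = _ := by rw [mul_pow]; ring

/-- Two measures with `k + 1` atoms on opposite sides of the origin on a grid of step `T / Ω`, whose
difference has vanishing moments of order less than `2 k + 1`. -/
theorem exists_close_of_disjoint_support (k : ℕ) {Ω T m : ℝ} (hΩ : 0 < Ω) (hT : 0 < T)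
    (hm : 0 < m) :
    ∃ (μs μ : DiscreteMeasure (k + 1)),
      μs.FullSupport ∧ μ.FullSupport ∧
      (∀ j : Fin (k + 1), μs.pos j = -((((k + 1 - j : ℕ) : ℝ)) * (T / Ω))) ∧
      (∀ j : Fin (k + 1), μ.pos j = ((j + 1 : ℕ) : ℝ) * (T / Ω)) ∧
      μ.tv ≤ μs.tv ∧ μs.tv = m ∧
      ∀ w, ‖μ.spectrum Ω w - μs.spectrum Ω w‖ ≤
        8 * (k + 1) * m / 4 ^ (k + 1) * T ^ (2 * k + 1) * |w| ^ (2 * k + 1) := by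
  set A : ℝ := (((2 * k + 1).choose (k + 1) : ℕ) : ℝ) with hA
  have hA4 : (4 : ℝ) ^ (k + 1) ≤ 4 * (k + 1) * A := by
    rw [hA]
    exact_mod_cast four_pow_le_mul_choose k
  have h4 : (0 : ℝ) < 4 ^ (k + 1) := by positivity
  have hk0 : (0 : ℝ) < k + 1 := by positivity
  have hA0 : 0 < A := by
    rw [hA]
    exact_mod_cast Nat.choose_pos (by omega)
  set c := m / ((k + 1) * A) with hc
  have hc0 : 0 < c := by positivity
  -- Weighting row `2k + 2` by the signed distance from its centre removes the atom at the origin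
  -- and leaves `k + 1` atoms on each side with equal total variation.
  set a : ℕ → ℝ := fun j =>
    c * ((-1) ^ (k + 1 - j) * ((k + 1 - j : ℕ) * ((2 * k + 2).choose j : ℕ))) with ha
  set b : ℕ → ℝ := fun j =>
    c * ((-1) ^ (j + 1) * ((j + 1 : ℕ) * ((2 * k + 2).choose (k + 2 + j) : ℕ))) with hb
  have habs : ∀ j, |a j| = c * ((k + 1 - j) * (2 * k + 2).choose j : ℕ) := by
    intro j
    simp [ha, abs_mul, abs_of_pos hc0]
  have hbbs : ∀ j, |b j| = c * ((j + 1) * (2 * k + 2).choose (k + 2 + j) : ℕ) := by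
    intro j
    simp only [hb, abs_mul, abs_of_pos hc0, abs_pow, abs_neg, abs_one, one_pow, one_mul,
      Nat.abs_cast]
    push_cast
    ring
  have htvs : ∑ j ∈ Finset.range (k + 1), |a j| = m := by
    simp_rw [habs]
    rw [← Finset.mul_sum, ← Nat.cast_sum, sum_mul_choose_reflect, sum_mul_choose_eq, hc, hA]
    push_cast
    rw [← hA]
    field_simp
  have htv : ∑ j ∈ Finset.range (k + 1), |b j| = m := by
    simp_rw [hbbs]
    rw [← Finset.mul_sum, ← Nat.cast_sum, sum_mul_choose_eq, hc, hA]
    push_cast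
    rw [← hA]
    field_simp
  refine ⟨gridMeasure Ω T hΩ hT (-(k + 1)) a, gridMeasure Ω T hΩ hT 1 b, ?_, ?_, ?_, ?_, ?_, ?_,
    ?_⟩
  · intro j
    rw [← abs_pos]
    change 0 < |a j|
    rw [habs]
    have h1 := Nat.choose_pos (show (j : ℕ) ≤ 2 * k + 2 by omega)
    have h2 : 0 < k + 1 - (j : ℕ) := by omega
    positivity
  · intro j
    rw [← abs_pos]
    change 0 < |b j|
    rw [hbbs]
    have h1 := Nat.choose_pos (show k + 2 + (j : ℕ) ≤ 2 * k + 2 by omega)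
    positivity
  · intro j
    simp only [gridMeasure]
    rw [Nat.cast_sub (by omega)]
    push_cast
    ring
  · intro j
    simp only [gridMeasure]
    push_cast
    ring
  · rw [gridMeasure_tv, gridMeasure_tv, htvs, htv]
  · rw [gridMeasure_tv, htvs]
  · intro w
    set ζ := Complex.exp ((-(w * T) : ℝ) * Complex.I) with hζ
    have hζ1 : ‖ζ‖ = 1 := Complex.norm_exp_ofReal_mul_I _
    have e1 := gridMeasure_pow_mul_spectrum (k := k + 1) hΩ hT (-(k + 1)) a (k + 1) w 0 (by simp)
    have e2 := gridMeasure_pow_mul_spectrum (k := k + 1) hΩ hT 1 b (k + 1) w (k + 2)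
      (by push_cast; ring)
    rw [← hζ] at e1 e2
    have s1 := sum_mul_neg_one_pow_choose_mul_pow (2 * k + 1) ζ
    have s2 := sum_neg_one_pow_choose_mul_pow (2 * k + 2) ζ
    -- The weighted sum is `-(2k+2) ζ (1-ζ)^{2k+1} - (k+1) (1-ζ)^{2k+2}`, and `2ζ + (1 - ζ) = 1 +
    -- ζ`.
    have e0 : ∑ i ∈ Finset.range (2 * k + 1 + 1 + 1), (c : ℂ) * (-1) ^ (k + 1) *
        (((i : ℂ) - (k + 1)) * ((-1) ^ i * ((2 * k + 2).choose i : ℂ) * ζ ^ i)) =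
        -(c * (-1) ^ (k + 1) * (k + 1) * (1 + ζ) * (1 - ζ) ^ (2 * k + 1)) := by
      rw [← Finset.mul_sum]
      simp only [sub_mul, Finset.sum_sub_distrib]
      rw [← Finset.mul_sum, s1, s2]
      push_cast
      ring
    have e3 : ζ ^ (k + 1) * ((gridMeasure (k := k + 1) Ω T hΩ hT 1 b).spectrum Ω w -
        (gridMeasure (k := k + 1) Ω T hΩ hT (-(k + 1)) a).spectrum Ω w) =
        -(c * (-1) ^ (k + 1) * (k + 1) * (1 + ζ) * (1 - ζ) ^ (2 * k + 1)) := by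
      rw [← e0, mul_sub, e1, e2, show 2 * k + 1 + 1 + 1 = (k + 1 + 1) + (k + 1) by ring,
        Finset.sum_range_add _ (k + 1 + 1) (k + 1), Finset.sum_range_succ _ (k + 1)]
      have z0 : (((k + 1 : ℕ) : ℂ) - (k + 1)) = 0 := by push_cast; ring
      rw [z0, zero_mul, mul_zero, add_zero, sub_eq_add_neg, ← Finset.sum_neg_distrib]
      have hsgn : ∀ i : ℕ, ((-1 : ℂ)) ^ (k + 1) * (-1) ^ (k + 1 + i) = (-1) ^ i := by
        intro i
        rw [← pow_add, show k + 1 + (k + 1 + i) = 2 * (k + 1) + i by ring, pow_add, pow_mul]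
        simp
      refine (add_comm _ _).trans (congrArg₂ (· + ·) ?_ ?_)
      · refine Finset.sum_congr rfl fun j hj => ?_
        have hj' : j ≤ k + 1 := (Finset.mem_range.1 hj).le
        simp only [ha, zero_add]
        have hs : ((-1 : ℂ)) ^ (k + 1) * (-1) ^ j = (-1) ^ (k + 1 - j) := by
          obtain ⟨q, hq⟩ : ∃ q, k + 1 = j + q := ⟨k + 1 - j, by omega⟩
          rw [hq, Nat.add_sub_cancel_left, pow_add, mul_comm ((-1 : ℂ) ^ j), mul_assoc, ← pow_add,
            Even.neg_one_pow ⟨j, rfl⟩, mul_one]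
        rw [Nat.cast_sub hj']
        push_cast
        linear_combination -(c : ℂ) * ((2 * k + 2).choose j : ℂ) * ζ ^ j * (j - (k + 1)) * hs
      · refine Finset.sum_congr rfl fun j _ => ?_
        simp only [hb]
        rw [show k + 1 + 1 + j = k + 1 + (j + 1) by ring]
        push_cast
        linear_combination -(c : ℂ) * ((2 * k + 2).choose (k + 1 + (j + 1)) : ℂ) *
          ζ ^ (k + 1 + (j + 1)) * (j + 1) * hsgn (j + 1)
    have e4 := congrArg norm e3
    have hn1 : ‖((k : ℂ) + 1)‖ = k + 1 := by
      rw [← Nat.cast_add_one, Complex.norm_natCast]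
      push_cast
      rfl
    rw [norm_mul, norm_pow, hζ1, one_pow, one_mul, norm_neg, norm_mul, norm_mul, norm_mul,
      norm_mul, norm_pow, norm_pow, norm_neg, norm_one, one_pow, mul_one, Complex.norm_real,
      Real.norm_eq_abs, abs_of_pos hc0, hn1] at e4
    rw [e4]
    have e5 := norm_one_sub_exp_le (w * T)
    rw [← hζ, abs_mul, abs_of_pos hT] at e5
    have e7 : ‖1 + ζ‖ ≤ 2 := by
      refine (norm_add_le _ _).trans ?_
      rw [norm_one, hζ1]
      norm_num
    have e6 : c * (k + 1) * 2 ≤ 8 * (k + 1) * m / 4 ^ (k + 1) := by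
      rw [hc, le_div_iff₀ h4]
      calc m / ((k + 1) * A) * (k + 1) * 2 * 4 ^ (k + 1)
          ≤ m / ((k + 1) * A) * (k + 1) * 2 * (4 * (k + 1) * A) := by gcongr
        _ = _ := by field_simp; ring
    calc c * (k + 1) * ‖1 + ζ‖ * ‖1 - ζ‖ ^ (2 * k + 1)
        ≤ c * (k + 1) * 2 * (|w| * T) ^ (2 * k + 1) := by gcongr
      _ ≤ 8 * (k + 1) * m / 4 ^ (k + 1) * (|w| * T) ^ (2 * k + 1) := by gcongr
      _ = _ := by rw [mul_pow]; ring

end SuperRes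

/-! ### Calibration of the constructions and final assembly -/

namespace SuperRes

open DiscreteMeasure

theorem exists_lowerEq {n : ℕ} (hn : 2 ≤ n) {σ m : ℝ} (hσ : 0 < σ) (hm : 0 < m) :
    ∃ d, LowerEq n σ m d := by
  have hn' : (2 : ℝ) ≤ n := by exact_mod_cast hn
  have := exists_div_eq_exp (a := 2 / Real.exp 1) (b := 2 * (n : ℝ) - 2) (c := (n : ℝ) - 1)
    (e := 1 / (2 * (n : ℝ) - 2)) (x := σ / m) (by positivity) (by linarith) (by linarith)
    (one_div_nonneg.2 (by linarith)) (by positivity) 0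
  simpa only [zero_add, LowerEq] using this

theorem exists_sharpEq {n : ℕ} (hn : 2 ≤ n) {σ m : ℝ} (hσ : 0 < σ) (hm : 0 < m) :
    ∃ d, SharpEq n σ m d := by
  have hn' : (2 : ℝ) ≤ n := by exact_mod_cast hn
  exact exists_div_eq_exp (a := 2 / Real.exp 1) (b := 2 * (n : ℝ) - 1) (c := (n : ℝ))
    (e := 1 / (2 * (n : ℝ) - 1)) (x := σ / m) (by positivity) (by linarith) (by linarith)
    (one_div_nonneg.2 (by linarith)) (by positivity) 1

theorem lowerEq_pow {k : ℕ} (hk : 1 ≤ k) {σ m d : ℝ} (hσ : 0 < σ) (hm : 0 < m)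
    (h : LowerEq (k + 1) σ m d) : 0 < d / k ∧
      (d / k) ^ (2 * k) = 4 ^ k / Real.exp (2 * k) * (2 * k / Real.exp d) * (σ / m) := by
  have hk0 : (0 : ℝ) < k := by exact_mod_cast hk
  rw [LowerEq] at h
  push_cast at h
  rw [show (k : ℝ) + 1 - 1 = k by ring, show 2 * ((k : ℝ) + 1) - 2 = 2 * k by ring] at h
  refine ⟨by rw [h]; positivity, ?_⟩
  have := pow_eq_of_eq_mul_rpow (p := 2 * k) (by omega) (by positivity) (by positivity)
    (by push_cast; rw [one_div]) h
  rw [this, div_pow, exp_pow_eq, pow_mul]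
  push_cast
  norm_num

theorem sharpEq_pow {k : ℕ} {σ m d : ℝ} (hσ : 0 < σ) (hm : 0 < m)
    (h : SharpEq (k + 1) σ m d) : 0 < d / (k + 1) ∧
      (d / (k + 1)) ^ (2 * k + 1) = 2 * 4 ^ k / Real.exp (2 * k + 1) *
        ((2 * k + 1) / Real.exp (1 + d)) * (σ / m) := by
  rw [SharpEq] at h
  push_cast at h
  rw [show 2 * ((k : ℝ) + 1) - 1 = 2 * k + 1 by ring] at h
  refine ⟨by rw [h]; positivity, ?_⟩
  have := pow_eq_of_eq_mul_rpow (p := 2 * k + 1) (by omega) (by positivity) (by positivity)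
    (by push_cast; rw [one_div]) h
  rw [this, div_pow, exp_pow_eq, pow_succ, pow_mul]
  push_cast
  norm_num
  left; left
  ring

theorem lower_bound_measures {k N : ℕ} (hk : 1 ≤ k) {Ω : ℝ} (hΩ : 0 < Ω) (R : ℝ) {h : ℝ}
    (hh : 0 < h) (hhπ : h ≤ Real.pi) {σ m d : ℝ} (hσ : 0 < σ) (hm : 0 < m)
    (hd : LowerEq (k + 1) σ m d) :
    ∃ (μs : DiscreteMeasure (k + 1)) (μ : DiscreteMeasure k),
      μs.FullSupport ∧ μ.FullSupport ∧ μs.SupportedIn (d / Ω) ∧ μ.SupportedIn (d / Ω) ∧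
      μ.tv ≤ μs.tv ∧ μs.tv = m ∧ μs.dMin = d / (k * Ω) ∧
      √(h / Ω) * ‖μ.image (psf Ω) (samplePoint Ω R h (N := N)) -
        μs.image (psf Ω) (samplePoint Ω R h (N := N))‖ ≤ σ := by
  have hk1 : (1 : ℝ) ≤ k := by exact_mod_cast hk
  obtain ⟨hT, hpow⟩ := lowerEq_pow hk hσ hm hd
  obtain ⟨μs, μ, h1, h2, h3, h4, h5, h6, h7, h8⟩ := exists_close_of_fewer_atoms hk hΩ hT hm
  have hkd : (k : ℝ) * (d / k) = d := by field_simp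
  have hd0 : 0 < d := by
    rw [← hkd]
    positivity
  rw [hkd] at h3 h4
  refine ⟨μs, μ, h1, h2, h3, h4, h5, h6, by rw [h7, div_div], ?_⟩
  refine (mul_norm_image_sub_le μ μs hΩ R hh hhπ (by positivity) (2 * k) h8).trans ?_
  have e1 : √(Real.pi / (2 * ((2 * k : ℕ) : ℝ) + 1)) ≤ 1 :=
    sqrt_pi_div_le_one (by push_cast; linarith)
  -- The equation for `d` cancels `m` and `4^k`; what remains beside `σ` is `4k e^{-2k} e^{-d} ≤ 1`.
  have e2 : 2 * m / 4 ^ k * (d / k) ^ (2 * k) =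
      4 * k / Real.exp (2 * k) * (1 / Real.exp d) * σ := by
    rw [hpow]
    field_simp
    ring
  have e3 : 4 * k / Real.exp (2 * k) ≤ 1 := by
    rw [div_le_one (Real.exp_pos _)]
    exact four_mul_le_exp k
  have e4 : 1 / Real.exp d ≤ 1 := by
    rw [div_le_one (Real.exp_pos _)]
    exact Real.one_le_exp hd0.le
  rw [e2]
  calc 4 * k / Real.exp (2 * k) * (1 / Real.exp d) * σ *
        √(Real.pi / (2 * ((2 * k : ℕ) : ℝ) + 1)) ≤ 1 * 1 * σ * 1 := by gcongr
    _ = σ := by ring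

theorem sharp_measures {k N : ℕ} (hk : 1 ≤ k) {Ω : ℝ} (hΩ : 0 < Ω) (R : ℝ) {h : ℝ}
    (hh : 0 < h) (hhπ : h ≤ Real.pi) {σ m d : ℝ} (hσ : 0 < σ) (hm : 0 < m)
    (hd : SharpEq (k + 1) σ m d) {τ : ℝ} (hτ : τ = d / (((k + 1 : ℕ) : ℝ) * Ω)) :
    ∃ μs μ : DiscreteMeasure (k + 1),
      μs.FullSupport ∧ μ.FullSupport ∧
      Set.range μs.pos = {y | ∃ j : ℕ, 1 ≤ j ∧ j ≤ k + 1 ∧ y = -((j : ℝ) * τ)} ∧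
      Set.range μ.pos = {y | ∃ j : ℕ, 1 ≤ j ∧ j ≤ k + 1 ∧ y = (j : ℝ) * τ} ∧
      μ.tv ≤ μs.tv ∧ μs.tv = m ∧
      √(h / Ω) * ‖μ.image (psf Ω) (samplePoint Ω R h (N := N)) -
        μs.image (psf Ω) (samplePoint Ω R h (N := N))‖ ≤ σ := by
  have hk1 : (1 : ℝ) ≤ k := by exact_mod_cast hk
  obtain ⟨hT, hpow⟩ := sharpEq_pow hσ hm hd
  obtain ⟨μs, μ, h1, h2, h3, h4, h5, h6, h8⟩ := exists_close_of_disjoint_support k hΩ hT hm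
  have hd0 : 0 < d := by
    have : d = d / (k + 1) * (k + 1) := by field_simp
    rw [this]
    positivity
  have hτ' : d / (k + 1) / Ω = τ := by
    rw [hτ, div_div]
    push_cast
    rfl
  rw [hτ'] at h3 h4
  refine ⟨μs, μ, h1, h2, ?_, ?_, h5, h6, ?_⟩
  · ext y
    constructor
    · rintro ⟨j, rfl⟩
      exact ⟨k + 1 - j, by omega, by omega, h3 j⟩
    · rintro ⟨j, hj1, hj2, rfl⟩
      refine ⟨⟨k + 1 - j, by omega⟩, ?_⟩
      rw [h3]
      congr 3
      simp only
      omega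
  · ext y
    constructor
    · rintro ⟨j, rfl⟩
      exact ⟨j + 1, by omega, by omega, h4 j⟩
    · rintro ⟨j, hj1, hj2, rfl⟩
      refine ⟨⟨j - 1, by omega⟩, ?_⟩
      rw [h4]
      congr 2
      simp only
      omega
  refine (mul_norm_image_sub_le μ μs hΩ R hh hhπ (by positivity) (2 * k + 1) h8).trans ?_
  have e1 : √(Real.pi / (2 * ((2 * k + 1 : ℕ) : ℝ) + 1)) ≤ 1 :=
    sqrt_pi_div_le_one (by push_cast; linarith)
  have e2 : 8 * (k + 1) * m / 4 ^ (k + 1) * (d / (k + 1)) ^ (2 * k + 1) =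
      4 * (k + 1) * (2 * k + 1) / Real.exp (2 * (k + 1 : ℕ)) * (1 / Real.exp d) * σ := by
    rw [hpow, show Real.exp (2 * ((k + 1 : ℕ) : ℝ)) = Real.exp (2 * k + 1) * Real.exp 1 by
      rw [← Real.exp_add]
      push_cast
      ring_nf, Real.exp_add 1 d]
    field_simp
    ring
  have e3 : 4 * (k + 1) * (2 * k + 1) / Real.exp (2 * (k + 1 : ℕ)) ≤ 1 := by
    -- With `n = k + 1` the numerator is `4n(2n-1) ≤ 8n²`, and `e² > 7` makes `8n² ≤ e^{2n}` for `n
    -- ≥ 2`.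
    rw [div_le_one (Real.exp_pos _)]
    refine le_trans ?_ (eight_mul_sq_le_exp (show 2 ≤ k + 1 by omega))
    push_cast
    nlinarith
  have e4 : 1 / Real.exp d ≤ 1 := by
    rw [div_le_one (Real.exp_pos _)]
    exact Real.one_le_exp hd0.le
  rw [e2]
  calc 4 * (k + 1) * (2 * k + 1) / Real.exp (2 * (k + 1 : ℕ)) * (1 / Real.exp d) * σ *
        √(Real.pi / (2 * ((2 * k + 1 : ℕ) : ℝ) + 1)) ≤ 1 * 1 * σ * 1 := by gcongr
    _ = σ := by ring

/-- The moment estimate in the form used for admissible measures. -/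
theorem abs_moment_sub_le_of_isAdmissible {l n N : ℕ} (hn : 0 < n) {Ω : ℝ} (hΩ : 0 < Ω)
    {R h : ℝ} (hh : 0 < h) (hhπ : h ≤ Real.pi) {d σ M : ℝ} (hσ : 0 < σ)
    {μs : DiscreteMeasure n} {W Y : EuclideanSpace ℂ (Fin N)} (hfull : μs.FullSupport)
    (hsupp : μs.SupportedIn (d / Ω)) (htv : μs.tv ≤ M) (hW : √h * ‖W‖ ≤ σ)
    (hY : Y = μs.image (psf Ω) (samplePoint Ω R h) + ((√Ω : ℝ) : ℂ) • W)
    (hs : 0 < sigmaMin Ω R h N (sStar d σ M)) {μ : DiscreteMeasure l}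
    (hμ : μ.IsAdmissible (psf Ω) (samplePoint Ω R h) (h / Ω) (d / Ω) σ M Y) (r : ℕ) :
    |μ.moment Ω r - μs.moment Ω r| ≤
      3 * σ / sigmaMin Ω R h N (sStar d σ M) * (√(2 * (r : ℝ) + 1) * r.factorial) :=
  abs_moment_sub_le μ μs hΩ hh hhπ
    ((abs_nonneg _).trans (abs_scaled_pos_le hΩ hsupp ⟨0, hn⟩)) hσ
    ((tv_pos hn hfull).trans_le htv) hμ.1 hsupp hμ.2.1 htv
    (mul_norm_image_sub_le_two_mul hΩ hh _ _ μ μs hW hY hμ.2.2) hs r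

theorem pow_mul_le_scaled_dMin_pow {A d Ω S σ m D e : ℝ} {p : ℕ} (hA : 0 < A) (hd : 0 ≤ d)
    (hΩ : 0 < Ω) (hS : 0 < S) (hσ : 0 < σ) (hm : 0 < m) (hp : p ≠ 0) (he : e = (p : ℝ)⁻¹)
    (h : D ≥ A * (1 + d) / Ω * (3 / S * (σ / m)) ^ e) :
    0 < D ∧ (A * (1 + d)) ^ p * (3 * σ / S / m) ≤ (Ω * D) ^ p := by
  refine ⟨lt_of_lt_of_le (by positivity) h, ?_⟩
  rw [show 3 * σ / S / m = 3 / S * (σ / m) by field_simp]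
  refine pow_mul_le_of_mul_rpow_le (by positivity) (by positivity) hp he ?_
  calc A * (1 + d) * (3 / S * (σ / m)) ^ e
      = Ω * (A * (1 + d) / Ω * (3 / S * (σ / m)) ^ e) := by field_simp
    _ ≤ Ω * D := by gcongr

end SuperRes

theorem mainTheorem12 (Ω : ℝ) (hΩ : 0 < Ω)
    -- sampling: `N` points from `-R/Ω` to `R/Ω` with spacing `h/Ω ≤ π/Ω`
    (N : ℕ) (R h : ℝ) (hR : 0 < R) (hh : 0 < h) (hhπ : h ≤ Real.pi)
    (hgrid : ((N : ℝ) - 1) * h = 2 * R)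
    (n : ℕ) (hn : 2 ≤ n) (σ : ℝ) (hσ : 0 < σ) :
    -- lower bound of the computational resolution limit
    (∀ m : ℝ, 0 < m →
      (∃ d, SuperRes.LowerEq n σ m d) ∧
      ∀ d, SuperRes.LowerEq n σ m d →
        ∃ (μs : SuperRes.DiscreteMeasure n) (μ : SuperRes.DiscreteMeasure (n - 1)),
          μs.FullSupport ∧ μ.FullSupport ∧
          μs.SupportedIn (d / Ω) ∧ μ.SupportedIn (d / Ω) ∧
          μ.tv ≤ μs.tv ∧ μs.tv = m ∧
          μs.dMin = d / (((n : ℝ) - 1) * Ω) ∧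
          √(h / Ω) * ‖μ.image (SuperRes.psf Ω) (SuperRes.samplePoint Ω R h (N := N)) -
            μs.image (SuperRes.psf Ω) (SuperRes.samplePoint Ω R h (N := N))‖ ≤ σ) ∧
    -- upper bound of the computational resolution limit
    (∀ (d M : ℝ) (μs : SuperRes.DiscreteMeasure n) (W Y : EuclideanSpace ℂ (Fin N)),
      μs.FullSupport → μs.SupportedIn (d / Ω) → μs.tv ≤ M →
      √h * ‖W‖ ≤ σ →
      Y = μs.image (SuperRes.psf Ω) (SuperRes.samplePoint Ω R h) + ((√Ω : ℝ) : ℂ) • W →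
      0 < SuperRes.sigmaMin Ω R h N (SuperRes.sStar d σ M) →
      μs.dMin ≥ 4.7 * (1 + d) / Ω *
        (3 / SuperRes.sigmaMin Ω R h N (SuperRes.sStar d σ M) * (σ / μs.mMin)) ^
          (1 / (2 * (n : ℝ) - 2)) →
      ∀ k < n, ∀ μ : SuperRes.DiscreteMeasure k,
        ¬ μ.IsAdmissible (SuperRes.psf Ω) (SuperRes.samplePoint Ω R h) (h / Ω) (d / Ω) σ M Y) ∧
    -- stability of the support recovery
    (∀ (d M : ℝ) (μs : SuperRes.DiscreteMeasure n) (W Y : EuclideanSpace ℂ (Fin N)),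
      μs.FullSupport → μs.SupportedIn (d / Ω) → μs.tv ≤ M →
      √h * ‖W‖ ≤ σ →
      Y = μs.image (SuperRes.psf Ω) (SuperRes.samplePoint Ω R h) + ((√Ω : ℝ) : ℂ) • W →
      0 < SuperRes.sigmaMin Ω R h N (SuperRes.sStar d σ M) →
      μs.dMin ≥ 6.24 * (1 + d) / Ω *
        (3 / SuperRes.sigmaMin Ω R h N (SuperRes.sStar d σ M) * (σ / μs.mMin)) ^
          (1 / (2 * (n : ℝ) - 1)) →
      ∀ μ : SuperRes.DiscreteMeasure n,
        μ.IsAdmissible (SuperRes.psf Ω) (SuperRes.samplePoint Ω R h) (h / Ω) (d / Ω) σ M Y →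
        ∀ i, |μ.pos i - μs.pos i| < μs.dMin / 2 ∧
          |μ.pos i - μs.pos i| ≤ SuperRes.stabConst n d / Ω *
            SuperRes.srf Ω μs.dMin ^ (2 * n - 2) *
            (3 * σ / (SuperRes.sigmaMin Ω R h N (SuperRes.sStar d σ M) * μs.mMin))) ∧
    -- sharpness of the stability result
    (∀ m : ℝ, 0 < m →
      (∃ d, SuperRes.SharpEq n σ m d) ∧
      ∀ d, SuperRes.SharpEq n σ m d → ∀ τ : ℝ, τ = d / ((n : ℝ) * Ω) →
        ∃ μs μ : SuperRes.DiscreteMeasure n,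
          μs.FullSupport ∧ μ.FullSupport ∧
          Set.range μs.pos = {y | ∃ j : ℕ, 1 ≤ j ∧ j ≤ n ∧ y = -((j : ℝ) * τ)} ∧
          Set.range μ.pos = {y | ∃ j : ℕ, 1 ≤ j ∧ j ≤ n ∧ y = (j : ℝ) * τ} ∧
          μ.tv ≤ μs.tv ∧ μs.tv = m ∧
          √(h / Ω) * ‖μ.image (SuperRes.psf Ω) (SuperRes.samplePoint Ω R h (N := N)) -
            μs.image (SuperRes.psf Ω) (SuperRes.samplePoint Ω R h (N := N))‖ ≤ σ) := by
  obtain ⟨k, rfl⟩ : ∃ k, n = k + 1 := ⟨n - 1, by omega⟩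
  have hk : 1 ≤ k := by omega
  refine ⟨fun m hm => ⟨SuperRes.exists_lowerEq hn hσ hm, fun d hd => ?_⟩, ?_, ?_,
    fun m hm => ⟨SuperRes.exists_sharpEq hn hσ hm, fun d hd τ hτ =>
      SuperRes.sharp_measures hk hΩ R hh hhπ hσ hm hd hτ⟩⟩
  · obtain ⟨μs, μ, h1, h2, h3, h4, h5, h6, h7, h8⟩ :=
      SuperRes.lower_bound_measures (N := N) hk hΩ R hh hhπ hσ hm hd
    refine ⟨μs, μ, h1, h2, h3, h4, h5, h6, ?_, h8⟩
    rw [h7, Nat.cast_add_one, add_sub_cancel_right]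
  · intro d M μs W Y hfull hsupp htv hW hY hs hsep l hl μ hμ
    -- The sign of `d` comes from the support: the interval contains at least one atom.
    have hd : 0 ≤ d := (abs_nonneg _).trans
      (SuperRes.DiscreteMeasure.abs_scaled_pos_le hΩ hsupp ⟨0, by omega⟩)
    obtain ⟨hD, hpow⟩ := SuperRes.pow_mul_le_scaled_dMin_pow (p := 2 * k) (by norm_num) hd hΩ hs hσ
      (SuperRes.DiscreteMeasure.mMin_pos (Nat.succ_pos k) hfull) (by omega)
      (by push_cast; rw [one_div]; congr 1; ring) hsep
    exact SuperRes.not_moments_close hk (by omega) μ μs hΩ hd (by positivity) hfull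
      (SuperRes.DiscreteMeasure.abs_scaled_pos_le hΩ hμ.1)
      (SuperRes.DiscreteMeasure.abs_scaled_pos_le hΩ hsupp) hpow hD
      (SuperRes.abs_moment_sub_le_of_isAdmissible (Nat.succ_pos k) hΩ hh hhπ hσ hfull hsupp htv hW
        hY hs hμ)
  · intro d M μs W Y hfull hsupp htv hW hY hs hsep μ hμ i
    have hd : 0 ≤ d := (abs_nonneg _).trans
      (SuperRes.DiscreteMeasure.abs_scaled_pos_le hΩ hsupp ⟨0, by omega⟩)
    have hm := SuperRes.DiscreteMeasure.mMin_pos (Nat.succ_pos k) hfull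
    obtain ⟨hD, hpow⟩ := SuperRes.pow_mul_le_scaled_dMin_pow (p := 2 * k + 1) (by norm_num) hd hΩ
      hs hσ hm (by omega) (by push_cast; rw [one_div]; congr 1; ring) hsep
    obtain ⟨h1, h2⟩ := SuperRes.atoms_close hk μ μs hΩ hd (by positivity) hfull
      (SuperRes.DiscreteMeasure.abs_scaled_pos_le hΩ hμ.1)
      (SuperRes.DiscreteMeasure.abs_scaled_pos_le hΩ hsupp) hpow hD
      (SuperRes.abs_moment_sub_le_of_isAdmissible (Nat.succ_pos k) hΩ hh hhπ hσ hfull hsupp htv hW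
        hY hs hμ) i
    rw [← mul_sub, abs_mul, abs_of_pos hΩ] at h1 h2
    refine ⟨?_, ?_⟩
    · rw [mul_div_assoc] at h1
      exact lt_of_mul_lt_mul_left h1 hΩ.le
    · have := SuperRes.le_stabConst_mul_srf_pow hd hΩ hD (by positivity) h2
      rwa [div_div] at this
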